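/- Let $k=\mathbb F_q$ be a finite field with $q$ elements, let $E/k$ be an elliptic curve, and let $B=\mathrm{End}_k(E)\otimes\mathbb Q$ be its algebra of endomorphisms defined over $k$. An involution of the first kind on $B$ is an anti-automorphism $\sigma$ with $\sigma^2=\mathrm{id}$ that is the identity on the center of $B$. Suppose that $E$ is of spinorial type, i.e. that $B$ admits an involution of the first kind different from the identity, and let $\sigma$ be a spin structure on $E$, i.e. an involution of the first kind on $B$ of orthogonal type (for every extension $K/\mathbb Q$, every finite-dimensional $K$-vector space $V$ and every isomorphism $K\otimes_{\mathbb Q}B\cong\mathrm{End}_K(V)$, the involution $\sigma_K$ is the adjoint involution of a nondegenerate symmetric bilinear form on $V$). Then $B$ is a quaternion algebra over $\mathbb Q$ (a central simple $\mathbb{Q}$-algebra of dimension $4$), and the following hold, where $\mathrm{Nrd}$ is the reduced norm of $B$. (1) The Frobenius endomorphism $\tau:(x,y)\mapsto(x^q,y^q)$ of $E$ is a unit of $B$ and a proper similitude of $(B,\sigma)$ with multiplier $q$: $$\mu(\tau)=\sigma(\tau)\,\tau=q=\mathrm{Nrd}(\tau).$$ (2) Let $\mathrm{GO}^+(B,\sigma)=\{g\in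 B^\times : \sigma(g)g\in\mathbb Q^\times,\ \mathrm{Nrd}(g)=\sigma(g)g\}$ be the group of proper similitudes, and let $W(\bar{\mathbb F}_q/\mathbb F_q)\subset\mathrm{Gal}(\bar{\mathbb F}_q/\mathbb F_q)$ be the Weil group, i.e. the subgroup generated by the geometric Frobenius $\mathrm{Frob}_{geom}$ (the inverse of $x\mapsto x^q$). There is exactly one group homomorphism $\rho_{E,\sigma}:W(\bar{\mathbb F}_q/\mathbb F_q)\to\mathrm{GO}^+(B,\sigma)$ with $\rho_{E,\sigma}(\mathrm{Frob}_{geom})=\tau$. -/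

import Mathlib

open scoped TensorProduct

universe u

namespace WeierstrassCurve

open Filter

namespace EndAux

variable {k L : Type*} [Field k] [Field L] [Algebra k L] {V : Affine L}

/-- The `x`-coordinate of a point (with value `0` at the point at infinity). -/
def xc : V.Point → L
  | .zero => 0
  | .some x _ _ => x

/-- The `y`-coordinate of a point (with value `0` at the point at infinity). -/
def yc : V.Point → L
  | .zero => 0
  | .some _ y _ => y

theorem ext_coord {P Q : V.Point} (hP : P ≠ 0) (hQ : Q ≠ 0) (hx : xc P = xc Q)
    (hy : yc P = yc Q) : P = Q := by
  rcases P with _ | ⟨x, y, h⟩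
  · exact absurd rfl hP
  rcases Q with _ | ⟨x', y', h'⟩
  · exact absurd rfl hQ
  simp only [xc, yc] at hx hy
  subst hx hy
  rfl

/-- Functions on the points that agree, off a finite set, with a quotient of polynomials
in the coordinates with coefficients in `k`. -/
def Rat (k : Type*) [Field k] [Algebra k L] (u : V.Point → L) : Prop :=
  ∃ a c : MvPolynomial (Fin 2) k, ∀ᶠ P in cofinite,
    MvPolynomial.aeval ![xc P, yc P] c ≠ 0 ∧
      u P = MvPolynomial.aeval ![xc P, yc P] a / MvPolynomial.aeval ![xc P, yc P] c

theorem finite_of_poly (f : Polynomial L) (hf : f ≠ 0) :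
    {P : V.Point | f.eval (xc P) = 0}.Finite := by
  classical
  have h1 : {x : L | f.eval x = 0}.Finite := by
    refine (f.roots.toFinset.finite_toSet).subset fun x hx => ?_
    simpa [hf] using hx
  have h2 : ∀ x : L, {P : V.Point | xc P = x}.Finite := by
    intro x
    by_cases hne : ∃ y, V.Nonsingular x y
    · obtain ⟨y, hy⟩ := hne
      refine (Set.toFinite ({0, .some x y hy, -(.some x y hy)} : Set V.Point)).subset ?_
      rintro (_ | ⟨x', y', h'⟩) hP
      · exact Or.inl rfl
      · simp only [xc, Set.mem_ofPred_eq] at hP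
        subst hP
        rcases Affine.Y_eq_of_X_eq h'.1 hy.1 rfl with h | h
        · subst h; exact Or.inr (Or.inl rfl)
        · subst h; exact Or.inr (Or.inr rfl)
    · refine (Set.finite_singleton (0 : V.Point)).subset ?_
      rintro (_ | ⟨x', y', h'⟩) hP
      · rfl
      · simp only [xc, Set.mem_ofPred_eq] at hP
        subst hP
        exact absurd ⟨_, h'⟩ hne
  refine (h1.biUnion fun x _ => h2 x).subset fun P hP => ?_
  simp only [Set.mem_iUnion]
  exact ⟨xc P, hP, rfl⟩

theorem dich_poly (a : MvPolynomial (Fin 2) k) :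
    (∀ᶠ P : V.Point in cofinite, MvPolynomial.aeval ![xc P, yc P] a = 0) ∨
      ∀ᶠ P : V.Point in cofinite, MvPolynomial.aeval ![xc P, yc P] a ≠ 0 := by
  classical
  let A : Polynomial (Polynomial L) := MvPolynomial.aeval ![Polynomial.C Polynomial.X, Polynomial.X] a
  have hA : ∀ x y : L, A.evalEval x y = MvPolynomial.aeval ![x, y] a := by
    intro x y
    have : ((Polynomial.evalEvalRingHom x y).comp
        (MvPolynomial.aeval (R := k) (S₁ := Polynomial (Polynomial L))
          ![Polynomial.C Polynomial.X, Polynomial.X]).toRingHom :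
          MvPolynomial (Fin 2) k →+* L) = (MvPolynomial.aeval ![x, y]).toRingHom := by
      apply MvPolynomial.ringHom_ext
      · intro r
        simp [IsScalarTower.algebraMap_apply k (Polynomial L) (Polynomial (Polynomial L)), Polynomial.algebraMap_apply]
      · intro i
        fin_cases i <;> simp
    exact DFunLike.congr_fun this a
  have hne0 : ∀ᶠ P : V.Point in cofinite, P ≠ 0 := (Set.finite_singleton 0).subset (by
    intro P hP; simpa using hP)
  obtain ⟨p, q, hpq⟩ := Affine.CoordinateRing.exists_smul_basis_eq (Affine.CoordinateRing.mk V A)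
  have key : ∀ x y : L, V.Equation x y → ∀ G H : Polynomial (Polynomial L),
      Affine.CoordinateRing.mk V G = Affine.CoordinateRing.mk V H →
        G.evalEval x y = H.evalEval x y := by
    intro x y h G H hGH
    obtain ⟨D, hD⟩ := AdjoinRoot.mk_eq_mk.mp hGH
    have := congrArg (Polynomial.evalEval x y) hD
    rw [Polynomial.evalEval_mul, h, zero_mul, Polynomial.evalEval_sub, sub_eq_zero] at this
    exact this
  by_cases hN : Algebra.norm (Polynomial L) (Affine.CoordinateRing.mk V A) = 0
  · left
    have : Module.Finite (Polynomial L) V.CoordinateRing :=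
      Module.Finite.of_basis (Affine.CoordinateRing.basis V)
    have : Module.Free (Polynomial L) V.CoordinateRing :=
      Module.Free.of_basis (Affine.CoordinateRing.basis V)
    have h0 : Affine.CoordinateRing.mk V A = 0 := Algebra.norm_eq_zero_iff.mp hN
    filter_upwards [hne0] with P hP
    rcases P with _ | ⟨x, y, h⟩
    · exact absurd rfl hP
    · show MvPolynomial.aeval ![x, y] a = 0
      rw [← hA, key x y h.1 A 0 (by rw [h0, map_zero]), Polynomial.evalEval_zero]
  · right
    have := finite_of_poly (V := V) _ hN
    filter_upwards [hne0, this.compl_mem_cofinite] with P hP hP2 hcon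
    apply hP2
    rcases P with _ | ⟨x, y, h⟩
    · exact absurd rfl hP
    · replace hcon : MvPolynomial.aeval ![x, y] a = 0 := hcon
      show Polynomial.eval x _ = 0
      rw [← hA] at hcon
      rw [← Polynomial.evalEval_C x y]
      have e := Affine.CoordinateRing.coe_norm_smul_basis (W' := V) p q
      rw [hpq] at e
      rw [key x y h.1 _ _ e, Polynomial.evalEval_mul]
      have e2 : Affine.CoordinateRing.mk V (Polynomial.C p + Polynomial.C q * Polynomial.X)
          = Affine.CoordinateRing.mk V A := by
        rw [← hpq, Affine.CoordinateRing.smul, Affine.CoordinateRing.smul]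
        simp
      rw [key x y h.1 _ _ e2, hcon, zero_mul]

theorem Rat.congr {u v : V.Point → L} (hu : Rat k u) (h : ∀ᶠ P in cofinite, v P = u P) :
    Rat k v := by
  obtain ⟨a, c, hac⟩ := hu
  refine ⟨a, c, ?_⟩
  filter_upwards [hac, h] with P h1 h2
  exact ⟨h1.1, h2.trans h1.2⟩

theorem Rat.poly (a : MvPolynomial (Fin 2) k) :
    Rat k (fun P : V.Point => MvPolynomial.aeval ![xc P, yc P] a) :=
  ⟨a, 1, Eventually.of_forall fun P => by simp⟩

theorem Rat.const (r : k) : Rat k (fun _ : V.Point => algebraMap k L r) :=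
  (Rat.poly (MvPolynomial.C r)).congr (Eventually.of_forall fun P => by simp)

theorem Rat.x : Rat k (xc (V := V)) :=
  (Rat.poly (MvPolynomial.X 0)).congr (Eventually.of_forall fun P => by simp)

theorem Rat.y : Rat k (yc (V := V)) :=
  (Rat.poly (MvPolynomial.X 1)).congr (Eventually.of_forall fun P => by simp)

theorem Rat.add {u v : V.Point → L} (hu : Rat k u) (hv : Rat k v) :
    Rat k (fun P => u P + v P) := by
  obtain ⟨a, c, h⟩ := hu
  obtain ⟨a', c', h'⟩ := hv
  refine ⟨a * c' + c * a', c * c', ?_⟩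
  filter_upwards [h, h'] with P h1 h2
  simp only [map_mul, map_add, h1.2, h2.2]
  exact ⟨mul_ne_zero h1.1 h2.1, div_add_div _ _ h1.1 h2.1⟩

theorem Rat.mul {u v : V.Point → L} (hu : Rat k u) (hv : Rat k v) :
    Rat k (fun P => u P * v P) := by
  obtain ⟨a, c, h⟩ := hu
  obtain ⟨a', c', h'⟩ := hv
  refine ⟨a * a', c * c', ?_⟩
  filter_upwards [h, h'] with P h1 h2
  simp only [map_mul, h1.2, h2.2]
  exact ⟨mul_ne_zero h1.1 h2.1, div_mul_div_comm _ _ _ _⟩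

theorem Rat.neg {u : V.Point → L} (hu : Rat k u) : Rat k (fun P => - u P) :=
  ((Rat.const (-1)).mul hu).congr (Eventually.of_forall fun P => by simp)

theorem Rat.sub {u v : V.Point → L} (hu : Rat k u) (hv : Rat k v) :
    Rat k (fun P => u P - v P) := by
  simpa only [sub_eq_add_neg] using hu.add hv.neg

theorem Rat.dich {u : V.Point → L} (hu : Rat k u) :
    (∀ᶠ P in cofinite, u P = 0) ∨ ∀ᶠ P in cofinite, u P ≠ 0 := by
  obtain ⟨a, c, h⟩ := hu
  rcases dich_poly (V := V) a with h0 | h0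
  · left
    filter_upwards [h, h0] with P h1 h2
    rw [h1.2, h2, zero_div]
  · right
    filter_upwards [h, h0] with P h1 h2
    rw [h1.2]
    exact div_ne_zero h2 h1.1

theorem Rat.div {u v : V.Point → L} (hu : Rat k u) (hv : Rat k v) :
    Rat k (fun P => u P / v P) := by
  rcases hv.dich with h0 | h0
  · refine (Rat.const (0 : k)).congr ?_
    filter_upwards [h0] with P h1
    simp [h1]
  · obtain ⟨a, c, h⟩ := hu
    obtain ⟨a', c', h'⟩ := hv
    refine ⟨a * c', c * a', ?_⟩
    filter_upwards [h, h', h0] with P h1 h2 h3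
    have h4 : MvPolynomial.aeval ![xc P, yc P] a' ≠ 0 := by
      intro h5; apply h3; rw [h2.2, h5, zero_div]
    simp only [map_mul, h1.2, h2.2]
    exact ⟨mul_ne_zero h1.1 h4, div_div_div_eq _ _ _ _⟩

theorem Rat.aeval {u v : V.Point → L} (hu : Rat k u) (hv : Rat k v)
    (a : MvPolynomial (Fin 2) k) :
    Rat k (fun P => MvPolynomial.aeval ![u P, v P] a) := by
  induction a using MvPolynomial.induction_on with
  | C r => exact (Rat.const r).congr (Eventually.of_forall fun P => by simp)
  | add p q hp hq => simpa only [map_add] using hp.add hq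
  | mul_X p i hp =>
    simp only [map_mul, MvPolynomial.aeval_X]
    refine hp.mul ?_
    fin_cases i
    · exact hu
    · exact hv

theorem Rat.extend {u : V.Point → L} (hu : Rat k u) : Rat L u := by
  obtain ⟨a, c, h⟩ := hu
  refine ⟨MvPolynomial.map (algebraMap k L) a, MvPolynomial.map (algebraMap k L) c, ?_⟩
  simpa [MvPolynomial.aeval_map_algebraMap] using h

theorem infinite_point [IsAlgClosed L] [V.IsElliptic] : Infinite V.Point := by
  have hex : ∀ x : L, ∃ y, V.Nonsingular x y := by
    intro x
    obtain ⟨y, hy⟩ := IsAlgClosed.exists_root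
      (Polynomial.X ^ 2 + Polynomial.C (V.a₁ * x + V.a₃) * Polynomial.X -
        Polynomial.C (x ^ 3 + V.a₂ * x ^ 2 + V.a₄ * x + V.a₆)) (by
        have : (Polynomial.X ^ 2 + Polynomial.C (V.a₁ * x + V.a₃) * Polynomial.X -
          Polynomial.C (x ^ 3 + V.a₂ * x ^ 2 + V.a₄ * x + V.a₆) : Polynomial L).degree = 2 := by
          compute_degree!
        rw [this]; decide)
    refine ⟨y, Affine.equation_iff_nonsingular.mp ?_⟩
    rw [Affine.equation_iff']
    simp only [Polynomial.IsRoot, Polynomial.eval_sub, Polynomial.eval_add, Polynomial.eval_pow,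
      Polynomial.eval_X, Polynomial.eval_mul, Polynomial.eval_C] at hy
    linear_combination hy
  choose y hy using hex
  have : Infinite L := IsAlgClosed.instInfinite
  exact Infinite.of_injective (fun x => Affine.Point.some x (y x) (hy x)) fun a b h => by
    simpa only [xc] using congrArg xc h

theorem eventually_ne_zero : ∀ᶠ P : V.Point in cofinite, P ≠ 0 :=
  (Set.finite_singleton (0 : V.Point)).compl_mem_cofinite

/-- The curve has coefficients in `k`. -/
structure CoeffIn (k : Type*) {L : Type*} [Field k] [Field L] [Algebra k L] (V : Affine L) :
    Prop where
  h₁ : ∃ r : k, algebraMap k L r = V.a₁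
  h₂ : ∃ r : k, algebraMap k L r = V.a₂
  h₃ : ∃ r : k, algebraMap k L r = V.a₃
  h₄ : ∃ r : k, algebraMap k L r = V.a₄

theorem Rat.const' {s : L} (hs : ∃ r : k, algebraMap k L r = s) :
    Rat k (fun _ : V.Point => s) := by
  obtain ⟨r, rfl⟩ := hs
  exact Rat.const r

theorem Rat.negY (hV : CoeffIn k V) {u v : V.Point → L} (hu : Rat k u) (hv : Rat k v) :
    Rat k (fun P => V.negY (u P) (v P)) := by
  unfold Affine.negY
  exact (hv.neg.sub ((Rat.const' hV.h₁).mul hu)).sub (Rat.const' hV.h₃)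

section Hom

variable [DecidableEq L]

theorem hom_const {φ : V.Point →+ V.Point} [Infinite V.Point] {Q : V.Point}
    (h : ∀ᶠ P in cofinite, φ P = Q) : φ = 0 := by
  -- every point is a difference of two points outside the exceptional set
  ext P
  have h2 : ∀ᶠ R in cofinite, φ (P + R) = Q :=
    (add_right_injective P).tendsto_cofinite.eventually h
  obtain ⟨R, hR1, hR2⟩ := (h.and h2).exists
  rw [map_add, hR1] at hR2
  simpa using hR2

end Hom

end EndAux

/-- An endomorphism `φ` of the group of `L`-points of a Weierstrass curve is *given by rational
functions with coefficients in `k`* if there are rational functions `a / c` and `b / c` with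
`a, b, c ∈ k[X, Y]` such that `φ (x, y) = (a (x, y) / c (x, y), b (x, y) / c (x, y))` for all but
finitely many points. -/
def IsGivenByRationalFunctions (k : Type*) {L : Type*} [Field k] [Field L] [Algebra k L]
    {V : Affine L} [DecidableEq L] (φ : V.Point →+ V.Point) : Prop :=
  ∃ a b c : MvPolynomial (Fin 2) k, ∀ᶠ P in cofinite,
    ∃ (x y : L) (h : V.Nonsingular x y), P = .some x y h ∧ MvPolynomial.aeval ![x, y] c ≠ 0 ∧
      ∃ h' : V.Nonsingular
          (MvPolynomial.aeval ![x, y] a / MvPolynomial.aeval ![x, y] c)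
          (MvPolynomial.aeval ![x, y] b / MvPolynomial.aeval ![x, y] c),
        φ P = .some _ _ h'

namespace EndAux

variable {k L : Type*} [Field k] [Field L] [Algebra k L] {V : Affine L} [DecidableEq L]

theorem given_iff {φ : V.Point →+ V.Point} :
    IsGivenByRationalFunctions k φ ↔ (∀ᶠ P in cofinite, φ P ≠ 0) ∧
      Rat k (fun P => xc (φ P)) ∧ Rat k (fun P => yc (φ P)) := by
  constructor
  · rintro ⟨a, b, c, h⟩
    refine ⟨?_, ⟨a, c, ?_⟩, ⟨b, c, ?_⟩⟩
    · filter_upwards [h] with P hP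
      obtain ⟨x, y, h, hP, hc, h', hφ⟩ := hP
      rw [hφ]
      exact Affine.Point.some_ne_zero h'
    · filter_upwards [h] with P hP
      obtain ⟨x, y, h, hP, hc, h', hφ⟩ := hP
      rw [hφ, hP]
      exact ⟨hc, rfl⟩
    · filter_upwards [h] with P hP
      obtain ⟨x, y, h, hP, hc, h', hφ⟩ := hP
      rw [hφ, hP]
      exact ⟨hc, rfl⟩
  · rintro ⟨h0, ⟨a, c, h1⟩, ⟨b, d, h2⟩⟩
    refine ⟨a * d, b * c, c * d, ?_⟩
    filter_upwards [h0, h1, h2, eventually_ne_zero] with P h0 h1 h2 hP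
    rcases P with _ | ⟨x, y, h⟩
    · exact absurd rfl hP
    refine ⟨x, y, h, rfl, ?_, ?_⟩
    · rw [map_mul]
      exact mul_ne_zero h1.1 h2.1
    · generalize φ (Affine.Point.some x y h) = Q at h0 h1 h2
      rcases Q with _ | ⟨x', y', h'⟩
      · exact absurd rfl h0
      have e1 : x' = MvPolynomial.aeval ![x, y] (a * d) / MvPolynomial.aeval ![x, y] (c * d) := by
        exact h1.2.trans (by rw [map_mul, map_mul]; exact (mul_div_mul_right _ _ h2.1).symm)
      have e2 : y' = MvPolynomial.aeval ![x, y] (b * c) / MvPolynomial.aeval ![x, y] (c * d) := by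
        exact h2.2.trans (by
          rw [mul_comm c d, map_mul, map_mul]; exact (mul_div_mul_right _ _ h1.1).symm)
      subst e1 e2
      exact ⟨h', rfl⟩

/-- Zero, or given by rational functions over `k`. -/
def Good (k : Type*) {L : Type*} [Field k] [Field L] [Algebra k L]
    {V : Affine L} [DecidableEq L] (φ : V.Point →+ V.Point) : Prop :=
  φ = 0 ∨ IsGivenByRationalFunctions k φ

theorem good_id : Good k (AddMonoidHom.id V.Point) :=
  Or.inr (given_iff.mpr ⟨eventually_ne_zero, Rat.x, Rat.y⟩)

theorem Good.comp [Infinite V.Point] {φ ψ : V.Point →+ V.Point} (hφ : Good k φ) (hψ : Good k ψ) :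
    Good k (φ.comp ψ) := by
  rcases hφ with rfl | hφ
  · left; ext P; simp
  rcases hψ with rfl | hψ
  · left; ext P; simp
  right
  rw [given_iff] at hφ hψ ⊢
  obtain ⟨h0, ⟨a, c, h1⟩, ⟨b, d, h2⟩⟩ := hφ
  obtain ⟨g0, gx, gy⟩ := hψ
  have fib : ∀ Q, ∀ᶠ P in cofinite, ψ P ≠ Q := by
    intro Q
    by_cases hQ : Q = 0
    · subst hQ; exact g0
    rcases (gx.extend.sub (Rat.const (xc Q))).dich with e1 | e1
    · rcases (gy.extend.sub (Rat.const (yc Q))).dich with e2 | e2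
      · exfalso
        have e3 : ∀ᶠ P in cofinite, ψ P = Q := by
          filter_upwards [g0, e1, e2] with P g e1 e2
          exact ext_coord g hQ (by simpa [sub_eq_zero] using e1)
            (by simpa [sub_eq_zero] using e2)
        have := hom_const e3
        subst this
        obtain ⟨P, hP⟩ := g0.exists
        exact hP rfl
      · filter_upwards [e2] with P hP hPQ
        apply hP
        simp [hPQ]
    · filter_upwards [e1] with P hP hPQ
      apply hP
      simp [hPQ]
  have ht : Tendsto ψ cofinite cofinite := by
    rw [Filter.Tendsto, Filter.le_cofinite_iff_eventually_ne]
    exact fun Q => fib Q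
  refine ⟨ht.eventually h0, ?_, ?_⟩
  · refine ((gx.aeval gy a).div (gx.aeval gy c)).congr ?_
    filter_upwards [ht.eventually h1] with P hP
    exact hP.2
  · refine ((gx.aeval gy b).div (gx.aeval gy d)).congr ?_
    filter_upwards [ht.eventually h2] with P hP
    exact hP.2

theorem Good.neg (hV : CoeffIn k V) {φ : V.Point →+ V.Point} (hφ : Good k φ) : Good k (-φ) := by
  rcases hφ with rfl | hφ
  · left; simp
  right
  rw [given_iff] at hφ ⊢
  obtain ⟨h0, hx, hy⟩ := hφ
  refine ⟨?_, hx.congr ?_, (Rat.negY hV hx hy).congr ?_⟩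
  · filter_upwards [h0] with P hP
    simpa using hP
  · refine Eventually.of_forall fun P => ?_
    rw [AddMonoidHom.neg_apply]
    generalize φ P = Q
    rcases Q with _ | ⟨x, y, h⟩ <;> rfl
  · filter_upwards [h0] with P hP
    rw [AddMonoidHom.neg_apply]
    generalize φ P = Q at hP
    rcases Q with _ | ⟨x, y, h⟩
    · exact absurd rfl hP
    · rfl

theorem Good.add (hV : CoeffIn k V) [Infinite V.Point] {φ ψ : V.Point →+ V.Point}
    (hφ : Good k φ) (hψ : Good k ψ) : Good k (φ + ψ) := by
  rcases hφ with rfl | hφ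
  · simpa using hψ
  rcases hψ with rfl | hψ
  · rw [add_zero]
    exact Or.inr hφ
  rw [given_iff] at hφ hψ
  obtain ⟨f0, fx, fy⟩ := hφ
  obtain ⟨g0, gx, gy⟩ := hψ
  -- it suffices to find a rational expression for the slope
  have fin : ∀ l : V.Point → L, Rat k l →
      (∀ᶠ P in cofinite, ¬ (xc (φ P) = xc (ψ P) ∧ yc (φ P) = V.negY (xc (ψ P)) (yc (ψ P))) ∧
        l P = V.slope (xc (φ P)) (xc (ψ P)) (yc (φ P)) (yc (ψ P))) → Good k (φ + ψ) := by
    intro l hl h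
    right
    rw [given_iff]
    have hX : Rat k (fun P => V.addX (xc (φ P)) (xc (ψ P)) (l P)) := by
      unfold Affine.addX
      simpa only [pow_two] using ((((hl.mul hl).add ((Rat.const' hV.h₁).mul hl)).sub
        (Rat.const' hV.h₂)).sub fx).sub gx
    have hY : Rat k (fun P => V.addY (xc (φ P)) (xc (ψ P)) (yc (φ P)) (l P)) := by
      unfold Affine.addY
      refine Rat.negY hV hX ?_
      unfold Affine.negAddY
      exact (hl.mul (hX.sub fx)).add fy
    have all : ∀ᶠ P in cofinite, (φ + ψ) P ≠ 0 ∧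
        xc ((φ + ψ) P) = V.addX (xc (φ P)) (xc (ψ P)) (l P) ∧
        yc ((φ + ψ) P) = V.addY (xc (φ P)) (xc (ψ P)) (yc (φ P)) (l P) := by
      filter_upwards [h, f0, g0] with P hP f g
      obtain ⟨h1, h2⟩ := hP
      rw [AddMonoidHom.add_apply]
      generalize φ P = Q at *
      generalize ψ P = R at *
      rcases Q with _ | ⟨x, y, hQ⟩
      · exact absurd rfl f
      rcases R with _ | ⟨x', y', hR⟩
      · exact absurd rfl g
      simp only [xc, yc] at h1 h2 ⊢
      rw [Affine.Point.add_some h1, h2]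
      exact ⟨Affine.Point.some_ne_zero _, rfl, rfl⟩
    exact ⟨all.mono fun P h => h.1, hX.congr (all.mono fun P h => h.2.1),
      hY.congr (all.mono fun P h => h.2.2)⟩
  rcases (fx.sub gx).dich with hx | hx
  · rcases (fy.sub (Rat.negY hV gx gy)).dich with hy | hy
    · left
      refine hom_const (Q := 0) ?_
      filter_upwards [hx, hy, f0, g0] with P hx hy f g
      rw [AddMonoidHom.add_apply]
      generalize φ P = Q at *
      generalize ψ P = R at *
      rcases Q with _ | ⟨x, y, hQ⟩
      · exact absurd rfl f
      rcases R with _ | ⟨x', y', hR⟩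
      · exact absurd rfl g
      exact Affine.Point.add_of_Y_eq (sub_eq_zero.mp hx) (sub_eq_zero.mp hy)
    · refine fin (fun P => (3 * (xc (φ P) * xc (φ P)) + 2 * V.a₂ * xc (φ P) + V.a₄
          - V.a₁ * yc (φ P)) / (yc (φ P) - V.negY (xc (φ P)) (yc (φ P)))) ?_ ?_
      · refine Rat.div (Rat.sub (Rat.add (Rat.add (Rat.mul (Rat.const' ⟨3, map_ofNat _ 3⟩) (fx.mul fx))
          (Rat.mul (Rat.mul (Rat.const' ⟨2, map_ofNat _ 2⟩) (Rat.const' hV.h₂)) fx))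
          (Rat.const' hV.h₄)) (Rat.mul (Rat.const' hV.h₁) fy)) (fy.sub (Rat.negY hV fx fy))
      · filter_upwards [hx, hy] with P hx hy
        refine ⟨fun h => hy (sub_eq_zero.mpr h.2), ?_⟩
        rw [Affine.slope_of_Y_ne (sub_eq_zero.mp hx) (fun h => hy (sub_eq_zero.mpr h)), pow_two]
  · refine fin (fun P => (yc (φ P) - yc (ψ P)) / (xc (φ P) - xc (ψ P)))
      ((fy.sub gy).div (fx.sub gx)) ?_
    filter_upwards [hx] with P hx
    refine ⟨fun h => hx (sub_eq_zero.mpr h.1), ?_⟩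
    rw [Affine.slope_of_X_ne (fun h => hx (sub_eq_zero.mpr h))]

end EndAux


/-! ### Endomorphisms of an elliptic curve -/

section Endomorphisms

variable {k : Type*} [Field k]

noncomputable instance decEqAlgClosure : DecidableEq (AlgebraicClosure k) := Classical.decEq _

/-- The group `E(k̄)` of points of `E` over the algebraic closure of `k`. -/
abbrev GeomPoint (E : WeierstrassCurve k) : Type _ :=
  (Affine.baseChange E (AlgebraicClosure k)).Point

theorem EndAux.coeffIn (E : WeierstrassCurve k) :
    EndAux.CoeffIn k (Affine.baseChange E (AlgebraicClosure k)) :=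
  ⟨⟨E.a₁, rfl⟩, ⟨E.a₂, rfl⟩, ⟨E.a₃, rfl⟩, ⟨E.a₄, rfl⟩⟩

instance EndAux.infinite_geomPoint (E : WeierstrassCurve k) [E.IsElliptic] :
    Infinite E.GeomPoint :=
  have : (Affine.baseChange E (AlgebraicClosure k)).IsElliptic :=
    inferInstanceAs (WeierstrassCurve.map E (algebraMap k (AlgebraicClosure k))).IsElliptic
  EndAux.infinite_point

/-- The ring `End_k(E)` of endomorphisms of the elliptic curve `E` that are defined over `k`:
the endomorphisms of the group `E(k̄)` that are zero or are given by rational functions with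
coefficients in `k`, with pointwise addition and with composition as multiplication. -/
def EndRing (E : WeierstrassCurve k) [E.IsElliptic] : Subring (AddMonoid.End E.GeomPoint) where
  carrier := {φ | φ = 0 ∨ IsGivenByRationalFunctions k φ}
  mul_mem' hφ hψ := EndAux.Good.comp hφ hψ
  one_mem' := EndAux.good_id
  add_mem' hφ hψ := EndAux.Good.add (EndAux.coeffIn E) hφ hψ
  zero_mem' := Or.inl rfl
  neg_mem' hφ := EndAux.Good.neg (EndAux.coeffIn E) hφ

/-- The endomorphism algebra `ℚ ⊗ End_k(E)`. -/
abbrev EndAlgebra (E : WeierstrassCurve k) [E.IsElliptic] : Type _ :=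
  TensorProduct ℤ ℚ E.EndRing

end Endomorphisms

section Frobenius

variable {k : Type*} [Field k] [Fintype k]

/-- The `q`-power Frobenius endomorphism `(x, y) ↦ (x ^ q, y ^ q)` of an elliptic curve over a
field with `q` elements. -/
noncomputable def frobeniusEnd (E : WeierstrassCurve k) [E.IsElliptic] : E.EndRing :=
  ⟨(Affine.Point.map (W' := E) (FiniteField.frobeniusAlgHom k (AlgebraicClosure k)) :
      E.GeomPoint →+ E.GeomPoint), by
    refine Or.inr ⟨MvPolynomial.X 0 ^ Fintype.card k, MvPolynomial.X 1 ^ Fintype.card k, 1, ?_⟩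
    filter_upwards [EndAux.eventually_ne_zero] with P hP
    rcases P with _ | ⟨x, y, h⟩
    · exact absurd rfl hP
    have h2 := (Affine.baseChange_nonsingular E
      (FiniteField.frobeniusAlgHom k (AlgebraicClosure k)).injective x y).mpr h
    refine ⟨x, y, h, rfl, by simp, by simpa using h2, ?_⟩
    rw [Affine.Point.map_some]
    simp⟩

/-- The class of the Frobenius endomorphism in the endomorphism algebra. -/
noncomputable def frobenius (E : WeierstrassCurve k) [E.IsElliptic] : E.EndAlgebra :=
  (1 : ℚ) ⊗ₜ[ℤ] E.frobeniusEnd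

end Frobenius

end WeierstrassCurve

/-! ### Involutions, reduced norms and similitudes -/

section Involutions

/-- An involution of the first kind on a ring `A`: an anti-automorphism of order dividing two
that is the identity on the center of `A`. -/
structure IsInvolutionOfFirstKind {A : Type*} [Ring A] (σ : A → A) : Prop where
  map_add : ∀ x y, σ (x + y) = σ x + σ y
  map_mul : ∀ x y, σ (x * y) = σ y * σ x
  involutive : ∀ x, σ (σ x) = x
  map_center : ∀ z ∈ Subring.center A, σ z = z

/-- An involution `σ` of the first kind on a central simple algebra `A` over `F` is of
*orthogonal type* if for every splitting `K ⊗ A ≃ End_K(V)` over a field extension `K` of `F`, the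
extension of `σ` to `K ⊗ A` is the adjoint involution of a nondegenerate symmetric bilinear form
on `V`. (Both sides of the adjunction identity are `K`-linear in the element of `K ⊗ A`, so it is
stated for the elements `1 ⊗ a`.) -/
def IsOfOrthogonalType (F : Type u) [Field F] {A : Type*} [Ring A] [Algebra F A] (σ : A → A) :
    Prop :=
  ∀ (K V : Type u) [Field K] [Algebra F K] [AddCommGroup V] [Module K V] [FiniteDimensional K V]
    (e : K ⊗[F] A ≃ₐ[K] Module.End K V),
    ∃ b : LinearMap.BilinForm K V, b.Nondegenerate ∧ b.IsSymm ∧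
      ∀ (a : A) (v w : V), b v (e (1 ⊗ₜ a) w) = b (e (1 ⊗ₜ σ a) v) w

/-- `r` is the reduced norm of the element `a` of the central simple algebra `A` over `F`: for every
splitting `K ⊗ A ≃ End_K(V)` over a field extension `K` of `F`, the determinant of the
endomorphism of `V` that corresponds to `a` is `r`. -/
def IsReducedNorm (F : Type u) [Field F] {A : Type*} [Ring A] [Algebra F A] (a : A) (r : F) :
    Prop :=
  ∀ (K V : Type u) [Field K] [Algebra F K] [AddCommGroup V] [Module K V] [FiniteDimensional K V]
    (e : K ⊗[F] A ≃ₐ[K] Module.End K V),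
    LinearMap.det (e (1 ⊗ₜ a)) = algebraMap F K r

/-- The degree of a central simple algebra `A` over `F`, the square root of its dimension. -/
noncomputable def csaDegree (F A : Type*) [Field F] [Ring A] [Algebra F A] : ℕ :=
  Nat.sqrt (Module.finrank F A)

variable {F : Type u} [Field F] {A : Type*} [Ring A] [Algebra F A] {σ : A → A}

theorem IsInvolutionOfFirstKind.map_one (hσ : IsInvolutionOfFirstKind σ) : σ 1 = 1 :=
  hσ.map_center 1 (one_mem _)

theorem similitude_mul (hσ : IsInvolutionOfFirstKind σ) {g h : A} {r s : F}
    (hg : σ g * g = algebraMap F A r) (hh : σ h * h = algebraMap F A s) :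
    σ (g * h) * (g * h) = algebraMap F A (r * s) := by
  rw [hσ.map_mul, mul_assoc, ← mul_assoc (σ g), hg, Algebra.left_comm, hh, ← _root_.map_mul]

theorem similitude_inv (hσ : IsInvolutionOfFirstKind σ) {g : Aˣ} {r : Fˣ}
    (hg : σ g * g = algebraMap F A r) :
    σ ↑g⁻¹ * ↑g⁻¹ = algebraMap F A ↑r⁻¹ := by
  have h1 : σ g = algebraMap F A r * ↑g⁻¹ := by rw [← hg, Units.mul_inv_cancel_right]
  have h2 : σ ↑g⁻¹ * σ g = 1 := by rw [← hσ.map_mul, Units.mul_inv, hσ.map_one]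
  rw [h1, Algebra.left_comm] at h2
  calc σ ↑g⁻¹ * ↑g⁻¹ = algebraMap F A (↑r⁻¹ * r) * (σ ↑g⁻¹ * ↑g⁻¹) := by simp
    _ = algebraMap F A ↑r⁻¹ := by rw [_root_.map_mul, mul_assoc, h2, mul_one]

/-- The group `GO(A, σ)` of similitudes of `(A, σ)`: the units `g` of `A` such that the multiplier
`μ(g) = σ(g) g` lies in `Fˣ`. -/
def GO (F : Type u) [Field F] {A : Type*} [Ring A] [Algebra F A] {σ : A → A}
    (hσ : IsInvolutionOfFirstKind σ) : Subgroup Aˣ where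
  carrier := {g | ∃ r : Fˣ, σ g * g = algebraMap F A r}
  mul_mem' := by
    rintro g h ⟨r, hr⟩ ⟨s, hs⟩
    exact ⟨r * s, similitude_mul hσ hr hs⟩
  one_mem' := ⟨1, by simp [hσ.map_one]⟩
  inv_mem' := by
    rintro g ⟨r, hr⟩
    exact ⟨r⁻¹, similitude_inv hσ hr⟩

/-- The group `GO⁺(A, σ)` of proper similitudes of `(A, σ)`, where `A` has degree `2m`: the
similitudes `g` with `Nrd(g) = μ(g) ^ m`. -/
def GOPlus (F : Type u) [Field F] {A : Type*} [Ring A] [Algebra F A] {σ : A → A}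
    (hσ : IsInvolutionOfFirstKind σ) : Subgroup Aˣ where
  carrier := {g | ∃ r : Fˣ, σ g * g = algebraMap F A r ∧
    IsReducedNorm F (g : A) ((r : F) ^ (csaDegree F A / 2))}
  mul_mem' := by
    rintro g h ⟨r, hr, hr'⟩ ⟨s, hs, hs'⟩
    refine ⟨r * s, similitude_mul hσ hr hs, ?_⟩
    intro K V _ _ _ _ _ e
    have : (1 : K) ⊗ₜ[F] ((g * h : Aˣ) : A) = (1 ⊗ₜ (g : A)) * (1 ⊗ₜ (h : A)) := by simp
    rw [this, _root_.map_mul, _root_.map_mul, hr' K V e, hs' K V e, ← _root_.map_mul,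
      Units.val_mul, mul_pow]
  one_mem' := by
    refine ⟨1, by simp [hσ.map_one], ?_⟩
    intro K V _ _ _ _ _ e
    rw [Units.val_one, ← Algebra.TensorProduct.one_def, _root_.map_one]
    simp
  inv_mem' := by
    rintro g ⟨r, hr, hr'⟩
    refine ⟨r⁻¹, similitude_inv hσ hr, ?_⟩
    intro K V _ _ _ _ _ e
    have h1 : LinearMap.det (e (1 ⊗ₜ (g : A))) * LinearMap.det (e (1 ⊗ₜ ((g⁻¹ : Aˣ) : A))) = 1 := by
      rw [← _root_.map_mul, ← _root_.map_mul, Algebra.TensorProduct.tmul_mul_tmul, mul_one,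
        Units.mul_inv, ← Algebra.TensorProduct.one_def, _root_.map_one, _root_.map_one]
    rw [hr' K V e] at h1
    rw [Units.val_inv_eq_inv_val, inv_pow, map_inv₀]
    exact eq_inv_of_mul_eq_one_right h1

end Involutions

/-! ### Spin structures -/

namespace WeierstrassCurve

variable {k : Type*} [Field k]

/-- An elliptic curve `E` over `k` is of *spinorial type* if its endomorphism algebra admits a
nontrivial involution of the first kind. -/
def IsOfSpinorialType (E : WeierstrassCurve k) [E.IsElliptic] : Prop :=
  ∃ σ : E.EndAlgebra → E.EndAlgebra, IsInvolutionOfFirstKind σ ∧ σ ≠ id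

/-- A *spin structure* `(B, σ)` on an elliptic curve `E` of spinorial type: an involution `σ`
of the first kind and of orthogonal type on the endomorphism algebra `B` of `E`. -/
structure IsSpinStructure (E : WeierstrassCurve k) [E.IsElliptic]
    (σ : E.EndAlgebra → E.EndAlgebra) : Prop where
  spinorial : E.IsOfSpinorialType
  firstKind : IsInvolutionOfFirstKind σ
  orthogonal : IsOfOrthogonalType ℚ σ

end WeierstrassCurve

/-! ### The Weil group of a finite field -/

section WeilGroup

variable (k : Type*) [Field k] [Fintype k]

/-- The geometric Frobenius in `Gal(k̄/k)`, the inverse of `x ↦ x ^ q`. -/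
noncomputable def geomFrobenius : Field.absoluteGaloisGroup k :=
  (FiniteField.frobeniusAlgEquivOfAlgebraic k (AlgebraicClosure k))⁻¹

/-- The Weil group `W(k̄/k)` of a finite field `k`: the subgroup of `Gal(k̄/k)` generated by
Frobenius. -/
noncomputable def weilGroup : Subgroup (Field.absoluteGaloisGroup k) :=
  Subgroup.zpowers (geomFrobenius k)

/-- The geometric Frobenius as an element of the Weil group. -/
noncomputable def weilGeomFrobenius : weilGroup k :=
  ⟨geomFrobenius k, Subgroup.mem_zpowers _⟩

end WeilGroup

/-! The engine is the degree of an endomorphism, built from x-coordinates alone. Since `φ (-P) = -φ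
P`, the function `x ∘ φ` is even, hence a reduced fraction `A(x) / B(x)`, and the degree is the
height `max (deg A) (deg B)`. Heights multiply under composition, so the degree is multiplicative,
and it vanishes only at `φ = 0`. The parallelogram law comes from `addSubMap`, a quadratic map of
the projective plane without base points that takes the symmetric functions of `x(P), x(Q)` to those
of `x(P + Q), x(P - Q)`. It doubles heights, while passing to symmetric functions adds them
(`HasDegree.parallelogram`).

A multiplicative anisotropic form with the parallelogram law satisfies `a² = tr(a) a - d(a)`
(`IsDegreeForm.mul_self_eq`). So in `B` every element is quadratic over `ℚ` and every nonzero
element is invertible. Such an algebra is a quaternion algebra as soon as it is noncommutative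
(`isQuaternionAlgebra_of_quadratic`); no prior finiteness of `B` is needed. Noncommutativity is what
spinorial type gives, because an involution of the first kind fixes the center.

Frobenius commutes with every endomorphism defined over `k`, so it lies in the center `ℚ` of `B`. It
is therefore a rational scalar `r`, and comparing degrees gives `r² = q`. As `σ` fixes scalars, the
multiplier is `r² = q`, and the reduced norm of a scalar in degree 2 is also `r²`. Finally the Weil
group is infinite cyclic, so a homomorphism from it is the free choice of the image of the
generator. -/

/-! ### Heights of vectors of polynomials -/

namespace Polynomial

variable {L : Type*} [Field L] {ι κ : Type*}

/-- `f` has degree at most `N`, and the coefficient of degree `N` is `a`. -/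
def IsTop (f : Polynomial L) (N : ℕ) (a : L) : Prop :=
  f.natDegree ≤ N ∧ f.coeff N = a

theorem IsTop.mul {f g : Polynomial L} {M N : ℕ} {a b : L} (hf : f.IsTop M a)
    (hg : g.IsTop N b) : (f * g).IsTop (M + N) (a * b) :=
  ⟨natDegree_mul_le_of_le hf.1 hg.1, by
    rw [coeff_mul_add_eq_of_natDegree_le hf.1 hg.1, hf.2, hg.2]⟩

theorem IsTop.add {f g : Polynomial L} {N : ℕ} {a b : L} (hf : f.IsTop N a)
    (hg : g.IsTop N b) : (f + g).IsTop N (a + b) :=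
  ⟨natDegree_add_le_of_degree_le hf.1 hg.1, by rw [coeff_add, hf.2, hg.2]⟩

theorem IsTop.C_zero (r : L) : (Polynomial.C r).IsTop 0 r :=
  ⟨(natDegree_C r).le, coeff_C_zero⟩

theorem IsTop.pow {f : Polynomial L} {N : ℕ} {a : L} (hf : f.IsTop N a) (n : ℕ) :
    (f ^ n).IsTop (n * N) (a ^ n) := by
  induction n with
  | zero => simpa using IsTop.C_zero (1 : L)
  | succ n ih => simpa only [pow_succ, Nat.succ_mul] using ih.mul hf

theorem IsTop.sum {s : Finset κ} {f : κ → Polynomial L} {N : ℕ} {a : κ → L}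
    (h : ∀ i ∈ s, (f i).IsTop N (a i)) : (∑ i ∈ s, f i).IsTop N (∑ i ∈ s, a i) :=
  ⟨natDegree_sum_le_of_forall_le s f fun i hi => (h i hi).1, by
    rw [finsetSum_coeff]
    exact Finset.sum_congr rfl fun i hi => (h i hi).2⟩

theorem IsTop.prod {s : Finset κ} {f : κ → Polynomial L} {N : κ → ℕ} {a : κ → L}
    (h : ∀ i ∈ s, (f i).IsTop (N i) (a i)) :
    (∏ i ∈ s, f i).IsTop (∑ i ∈ s, N i) (∏ i ∈ s, a i) := by
  classical
  induction s using Finset.induction_on with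
  | empty => simpa using IsTop.C_zero (1 : L)
  | insert j s hj ih =>
    rw [Finset.prod_insert hj, Finset.sum_insert hj, Finset.prod_insert hj]
    exact (h j (Finset.mem_insert_self j s)).mul
      (ih fun i hi => h i (Finset.mem_insert_of_mem hi))

/-- Each monomial of degree `m` contributes in degree `m * N` exactly the product of the top
coefficients. Taking the coefficient of degree `N` thus acts as evaluation at infinity. -/
theorem IsTop.aeval {F : MvPolynomial ι L} {m : ℕ} (hF : F.IsHomogeneous m)
    {s : ι → Polynomial L} {N : ℕ} {a : ι → L} (h : ∀ i, (s i).IsTop N (a i)) :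
    (MvPolynomial.aeval s F).IsTop (m * N) (MvPolynomial.eval a F) := by
  rw [MvPolynomial.aeval_def, MvPolynomial.eval₂_eq, MvPolynomial.eval_eq]
  refine IsTop.sum fun d hd => ?_
  have h1 : ∑ i ∈ d.support, d i * N = m * N := by
    have := hF (MvPolynomial.mem_support_iff.mp hd)
    rw [← Finset.sum_mul, ← this, Finsupp.weight_apply, Finsupp.sum]
    simp
  have h2 := (IsTop.C_zero (MvPolynomial.coeff d F)).mul
    (IsTop.prod (s := d.support) fun i _ => (h i).pow (d i))
  rwa [h1, zero_add] at h2

/-- The vector `s` of polynomials, without common root, has height (largest degree) `N`. -/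
structure HasHeight (s : ι → Polynomial L) (N : ℕ) : Prop where
  natDegree_le : ∀ i, (s i).natDegree ≤ N
  eval_ne_zero : ∀ x, (fun i => (s i).eval x) ≠ 0
  coeff_ne_zero : (fun i => (s i).coeff N) ≠ 0

theorem HasHeight.isTop {s : ι → Polynomial L} {N : ℕ} (h : HasHeight s N) (i : ι) :
    (s i).IsTop N ((s i).coeff N) :=
  ⟨h.natDegree_le i, rfl⟩

theorem HasHeight.le_of_natDegree_le {s : ι → Polynomial L} {N M : ℕ} (h : HasHeight s N)
    (hM : ∀ i, (s i).natDegree ≤ M) : N ≤ M := by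
  obtain ⟨i, hi⟩ := Function.ne_iff.mp h.coeff_ne_zero
  exact (le_natDegree_of_ne_zero hi).trans (hM i)

theorem HasHeight.span_eq_top [IsAlgClosed L] {s : ι → Polynomial L} {N : ℕ}
    (h : HasHeight s N) : Ideal.span (Set.range s) = ⊤ := by
  obtain ⟨g, hg⟩ := IsPrincipalIdealRing.principal (Ideal.span (Set.range s))
  have hdvd : ∀ i, g ∣ s i := fun i =>
    Ideal.mem_span_singleton.mp (hg.le (Ideal.subset_span ⟨i, rfl⟩))
  have hroot : ∀ x, g.eval x ≠ 0 := fun x hx => h.eval_ne_zero x (by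
    ext i
    exact eval_eq_zero_of_dvd_of_eval_eq_zero (hdvd i) hx)
  have hu : IsUnit g := by
    by_contra hu
    by_cases h0 : g.degree = 0
    · exact hu (isUnit_iff_degree_eq_zero.mpr h0)
    · obtain ⟨x, hx⟩ := IsAlgClosed.exists_root g h0
      exact hroot x hx
  rw [hg]
  exact Ideal.span_singleton_eq_top.mpr hu

/-- Without common root the entries generate the unit ideal. From `1 = ∑ u i * s i`, the factor is
`∑ u i * t i`. -/
theorem HasHeight.dvd [Fintype ι] [IsAlgClosed L] {s t : ι → Polynomial L} {N : ℕ}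
    (hs : HasHeight s N) (hst : ∀ i j, s i * t j = s j * t i) :
    ∃ r, ∀ j, t j = r * s j := by
  have h1 : (1 : Polynomial L) ∈ Ideal.span (Set.range s) := by
    rw [hs.span_eq_top]; trivial
  obtain ⟨u, hu⟩ := Ideal.mem_span_range_iff_exists_fun.mp h1
  refine ⟨∑ i, u i * t i, fun j => ?_⟩
  calc t j = (∑ i, u i * s i) * t j := by rw [hu, one_mul]
    _ = ∑ i, u i * (s i * t j) := by rw [Finset.sum_mul]; simp only [mul_assoc]
    _ = (∑ i, u i * t i) * s j := by
      rw [Finset.sum_mul]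
      exact Finset.sum_congr rfl fun i _ => by rw [hst i j]; ring

/-- Proportional vectors without common root have the same height. -/
theorem HasHeight.unique [Fintype ι] [IsAlgClosed L] {s t : ι → Polynomial L} {N M : ℕ}
    (hs : HasHeight s N) (ht : HasHeight t M) (hst : ∀ i j, s i * t j = s j * t i) :
    N = M := by
  have key : ∀ {s t : ι → Polynomial L} {N M : ℕ}, HasHeight s N → HasHeight t M →
      (∀ i j, s i * t j = s j * t i) → N ≤ M := by
    intro s t N M hs ht hst
    obtain ⟨r, hr⟩ := hs.dvd hst
    refine hs.le_of_natDegree_le fun i => ?_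
    by_cases hsi : s i = 0
    · simp [hsi]
    have hr0 : r ≠ 0 := by
      rintro rfl
      exact ht.coeff_ne_zero (by ext j; simp [hr])
    exact (natDegree_le_of_dvd (Dvd.intro_left r (hr i).symm)
      (by rw [hr]; exact mul_ne_zero hr0 hsi)).trans (ht.natDegree_le i)
  exact le_antisymm (key hs ht hst)
    (key ht hs fun i j => by rw [mul_comm, hst j i, mul_comm])

theorem eval_mvPolynomial_aeval (s : ι → Polynomial L) (F : MvPolynomial ι L) (x : L) :
    (MvPolynomial.aeval s F).eval x = MvPolynomial.eval (fun i => (s i).eval x) F := by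
  induction F using MvPolynomial.induction_on with
  | C r => simp
  | add p q hp hq => simp [hp, hq]
  | mul_X p i hp => simp [hp]

/-- A homogeneous map without nontrivial zeros preserves nonvanishing at each finite point and at
infinity, so nothing cancels and the height is exactly multiplied by the degree. -/
theorem HasHeight.aeval {s : ι → Polynomial L} {N m : ℕ} (hs : HasHeight s N)
    {F : κ → MvPolynomial ι L} (hF : ∀ i, (F i).IsHomogeneous m)
    (hF0 : ∀ x : ι → L, x ≠ 0 → (fun i => (F i).eval x) ≠ 0) :
    HasHeight (fun i => MvPolynomial.aeval s (F i)) (m * N) where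
  natDegree_le i := (IsTop.aeval (hF i) hs.isTop).1
  eval_ne_zero x := by
    simpa only [eval_mvPolynomial_aeval] using hF0 _ (hs.eval_ne_zero x)
  coeff_ne_zero := by
    simpa only [(IsTop.aeval (hF _) hs.isTop).2] using hF0 _ hs.coeff_ne_zero

/-! ### Symmetric products and composition of maps of the projective line -/

/-- The symmetric product of two points of the projective line, as a point of the plane. -/
def sym2 {R : Type*} [CommSemiring R] (s t : Fin 2 → R) : Fin 3 → R :=
  ![s 0 * t 0, s 0 * t 1 + s 1 * t 0, s 1 * t 1]

/-- The entries are the coefficients of the product of two nonzero linear forms. -/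
theorem sym2_ne_zero {s t : Fin 2 → L} (hs : s ≠ 0) (ht : t ≠ 0) : sym2 s t ≠ 0 := by
  intro h
  have h0 : s 0 * t 0 = 0 := congrFun h 0
  have h1 : s 0 * t 1 + s 1 * t 0 = 0 := congrFun h 1
  have h2 : s 1 * t 1 = 0 := congrFun h 2
  have hs' : s 0 ≠ 0 ∨ s 1 ≠ 0 := by
    by_contra! hc
    exact hs (by ext i; fin_cases i; exacts [hc.1, hc.2])
  have ht' : t 0 ≠ 0 ∨ t 1 ≠ 0 := by
    by_contra! hc
    exact ht (by ext i; fin_cases i; exacts [hc.1, hc.2])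
  grind

theorem HasHeight.sym2 {s t : Fin 2 → Polynomial L} {M N : ℕ} (hs : HasHeight s M)
    (ht : HasHeight t N) : HasHeight (Polynomial.sym2 s t) (M + N) := by
  have htop : ∀ i, (Polynomial.sym2 s t i).IsTop (M + N)
      (Polynomial.sym2 (fun i => (s i).coeff M) (fun i => (t i).coeff N) i) := by
    intro i
    fin_cases i
    · exact (hs.isTop 0).mul (ht.isTop 0)
    · exact ((hs.isTop 0).mul (ht.isTop 1)).add ((hs.isTop 1).mul (ht.isTop 0))
    · exact (hs.isTop 1).mul (ht.isTop 1)
  refine ⟨fun i => (htop i).1, fun x => ?_, ?_⟩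
  · convert sym2_ne_zero (hs.eval_ne_zero x) (ht.eval_ne_zero x) using 1
    ext i
    fin_cases i <;> simp [Polynomial.sym2]
  · simpa only [(htop _).2] using sym2_ne_zero hs.coeff_ne_zero ht.coeff_ne_zero

/-- The height is the larger degree. If both coefficients vanished there, the polynomial of larger
degree would be zero, and then the other one too, against coprimality. -/
theorem _root_.IsCoprime.hasHeight {s : Fin 2 → Polynomial L} (h : IsCoprime (s 0) (s 1)) :
    ∃ N, HasHeight s N := by
  refine ⟨max (s 0).natDegree (s 1).natDegree, ?_, ?_, ?_⟩
  · intro i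
    fin_cases i
    · exact le_max_left _ _
    · exact le_max_right _ _
  · intro x hx
    obtain ⟨u, v, huv⟩ := h
    have := congrArg (eval x) huv
    have h0 : (s 0).eval x = 0 := congrFun hx 0
    have h1 : (s 1).eval x = 0 := congrFun hx 1
    simp [h0, h1] at this
  · intro hc
    have h0 : (s 0).coeff (max (s 0).natDegree (s 1).natDegree) = 0 := congrFun hc 0
    have h1 : (s 1).coeff (max (s 0).natDegree (s 1).natDegree) = 0 := congrFun hc 1
    have hlead : ∀ f : Polynomial L, f.coeff f.natDegree = 0 → f = 0 :=
      fun f hf => leadingCoeff_eq_zero.mp hf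
    rcases le_total (s 0).natDegree (s 1).natDegree with hle | hle
    · rw [max_eq_right hle] at h0 h1
      have e1 := hlead _ h1
      rw [e1, natDegree_zero] at h0 hle
      have e0 : s 0 = 0 := by
        rw [eq_C_of_natDegree_le_zero hle, h0, C_0]
      rw [e0, e1] at h
      exact not_isCoprime_zero_zero h
    · rw [max_eq_left hle] at h0 h1
      have e1 := hlead _ h0
      rw [e1, natDegree_zero] at h1 hle
      have e0 : s 1 = 0 := by
        rw [eq_C_of_natDegree_le_zero hle, h1, C_0]
      rw [e0, e1] at h
      exact not_isCoprime_zero_zero h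

theorem HasHeight.eval_homogenize_ne_zero {s : Fin 2 → Polynomial L} {N : ℕ}
    (hs : HasHeight s N) {x : Fin 2 → L} (hx : x ≠ 0) :
    (fun i => MvPolynomial.eval x ((s i).homogenize N)) ≠ 0 := by
  -- The point at infinity, where only the coefficient of degree `N` survives, is separated from the
  -- affine points `x 0 / x 1`.
  by_cases h1 : x 1 = 0
  · have h0 : x 0 ≠ 0 := fun h0 => hx (by ext i; fin_cases i; exacts [h0, h1])
    have key : ∀ f : Polynomial L,
        MvPolynomial.eval x (f.homogenize N) = f.coeff N * x 0 ^ N := by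
      intro f
      rw [homogenize, map_sum, Finset.sum_eq_single (N, 0)]
      · rw [MvPolynomial.eval_monomial, Finsupp.prod_fintype _ _ (by simp)]
        simp
      · rintro ⟨a, b⟩ hab hne
        have hb : b ≠ 0 := by
          rintro rfl
          simp at hab
          exact hne (by rw [hab])
        rw [MvPolynomial.eval_monomial, Finsupp.prod_fintype _ _ (by simp)]
        simp [h1, hb]
      · simp
    intro hc
    apply hs.coeff_ne_zero
    ext i
    have := congrFun hc i
    simpa [key, h0] using this
  · intro hc
    apply hs.eval_ne_zero (x 0 / x 1)
    ext i
    have := congrFun hc i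
    simpa [eval_homogenize (hs.natDegree_le i) x h1, h1] using this

theorem HasHeight.comp {s t : Fin 2 → Polynomial L} {M N : ℕ} (hs : HasHeight s M)
    (ht : HasHeight t N) :
    HasHeight (fun i => MvPolynomial.aeval t ((s i).homogenize M)) (M * N) :=
  ht.aeval (fun i => isHomogeneous_homogenize (s i)) fun _ => hs.eval_homogenize_ne_zero

end Polynomial

/-! ### The addition-and-subtraction map on points -/

namespace WeierstrassCurve.Affine.Point

variable {L : Type*} [Field L]

theorem eval_addSubMap (V : WeierstrassCurve L) (v : Fin 3 → L) :
    (fun i => MvPolynomial.eval v (V.addSubMap i)) =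
      ![v 0 ^ 2 - V.b₄ * v 0 * v 2 - V.b₆ * v 1 * v 2 - V.b₈ * v 2 ^ 2,
        2 * v 1 * v 0 + V.b₂ * v 0 * v 2 + V.b₄ * v 1 * v 2 + V.b₆ * v 2 ^ 2,
        v 1 ^ 2 - 4 * v 0 * v 2] := by
  ext i
  fin_cases i <;> simp [addSubMap]

theorem eval_smul_addSubMap (V : WeierstrassCurve L) (e : L) (v : Fin 3 → L) :
    (fun i => MvPolynomial.eval (e • v) (V.addSubMap i)) =
      e ^ 2 • fun i => MvPolynomial.eval v (V.addSubMap i) := by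
  rw [eval_addSubMap, eval_addSubMap]
  ext i
  fin_cases i <;> simp <;> ring

variable [DecidableEq L] {V : Affine L}

theorem addSubMap_sym2x_self (P : V.Point) :
    ∃ r : L, (fun i => MvPolynomial.eval (P.sym2x P) (addSubMap V i)) =
      r • (P + P).sym2x 0 := by
  rcases P with _ | ⟨x, y, h⟩
  · rw [← zero_def]
    refine ⟨1, ?_⟩
    simp [eval_addSubMap]
  have heq := (equation_iff' _ _).mp h.1
  by_cases hy : y = V.negY x y
  · rw [add_self_of_Y_eq hy]
    -- For a 2-torsion point the target is `(1 : 0 : 0)`, so the factor is the numerator of the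
    -- duplication formula. The middle coordinate is `(2y + a₁x + a₃)²`, which vanishes.
    refine ⟨(x ^ 2) ^ 2 - V.b₄ * x ^ 2 - V.b₆ * (x + x) - V.b₈, ?_⟩
    rw [negY] at hy
    rw [eval_addSubMap]
    ext i
    fin_cases i
    · simp; ring
    · simp [b₂, b₄, b₆]
      linear_combination (2 * y + V.a₁ * x + V.a₃) * hy - 4 * heq
    · simp; ring
  · rw [add_self_of_Y_ne hy]
    have hd : y - V.negY x y ≠ 0 := sub_ne_zero.mpr hy
    refine ⟨(y - V.negY x y) ^ 2, ?_⟩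
    rw [sym2x_some_some, sym2x_some_zero, slope_of_Y_ne rfl hy, eval_addSubMap]
    obtain ⟨d, hd'⟩ : ∃ d, d = y - V.negY x y := ⟨_, rfl⟩
    rw [← hd'] at hd ⊢
    ext i
    fin_cases i
    · simp [addX]
      field_simp
      simp only [hd', negY, b₄, b₆, b₈]
      linear_combination (V.a₁ ^ 2 + 4 * V.a₂ + 8 * x) * heq
    · simp [hd', negY, b₂, b₄, b₆]
      linear_combination - 4 * heq
    · simp; ring

theorem addSubMap_sym2x_of_X_ne {x₁ x₂ y₁ y₂ : L} (h₁ : V.Nonsingular x₁ y₁)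
    (h₂ : V.Nonsingular x₂ y₂) (hx : x₁ ≠ x₂) :
    ∃ r : L, (fun i => MvPolynomial.eval ((some _ _ h₁).sym2x (some _ _ h₂)) (addSubMap V i)) =
      r • (some _ _ h₁ + some _ _ h₂).sym2x (some _ _ h₁ - some _ _ h₂) := by
  have e₁ := (equation_iff' _ _).mp h₁.1
  have e₂ := (equation_iff' _ _).mp h₂.1
  have hd : x₁ - x₂ ≠ 0 := sub_ne_zero.mpr hx
  rw [sub_eq_add_neg, neg_some, add_of_X_ne hx, add_of_X_ne hx, sym2x_some_some, sym2x_some_some,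
    slope_of_X_ne hx, slope_of_X_ne hx]
  -- The factor is forced by the last coordinate, the discriminant `(x₁ + x₂)² - 4x₁x₂`.
  refine ⟨(x₁ - x₂) ^ 2, ?_⟩
  rw [eval_addSubMap]
  ext i
  fin_cases i
  · simp [addX]
    field_simp
    simp only [b₄, b₆, b₈]
    -- The left side is the product of the slope numerators for `P + Q` and `P - Q`; the difference
    -- of the curve equations makes it divisible by `x₁ - x₂`.
    have hNM : (y₁ - y₂) * (y₁ - (-y₂ - V.a₁ * x₂ - V.a₃)) = (x₁ - x₂) *
      (x₁ ^ 2 + x₁ * x₂ + x₂ ^ 2 + V.a₂ * (x₁ + x₂) + V.a₄ - V.a₁ * y₁) := by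
      linear_combination e₁ - e₂
    linear_combination (-((y₁ - y₂) * (y₁ - (-y₂ - V.a₁ * x₂ - V.a₃)) + (x₁ - x₂) *
      (x₁ ^ 2 + x₁ * x₂ + x₂ ^ 2 + V.a₂ * (x₁ + x₂) + V.a₄ - V.a₁ * y₁) +
      V.a₁ * (x₁ - x₂) * (2 * y₁ + V.a₁ * x₂ + V.a₃) + V.a₁ ^ 2 * (x₁ - x₂) ^ 2)) * hNM +
      (x₁ - x₂) ^ 2 * (V.a₁ ^ 2 * e₁ + 2 * (V.a₂ + x₁ + x₂) * (e₁ + e₂))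
  · simp [addX]
    field_simp
    simp only [b₂, b₄, b₆]
    linear_combination -2 * e₁ - 2 * e₂
  · simp; ring

/-- The map `addSubMap` sends `(x(P) x(Q) : x(P) + x(Q) : 1)` to
`(x(P + Q) x(P - Q) : x(P + Q) + x(P - Q) : 1)`. -/
theorem addSubMap_sym2x (P Q : V.Point) :
    ∃ r : L, (fun i => MvPolynomial.eval (P.sym2x Q) (addSubMap V i)) =
      r • (P + Q).sym2x (P - Q) := by
  by_cases h : P = Q ∨ P = -Q
  · rcases h with rfl | rfl
    · simpa using addSubMap_sym2x_self P
    · obtain ⟨r, hr⟩ := addSubMap_sym2x_self Q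
      refine ⟨r, ?_⟩
      rw [sym2x_neg_left, neg_add_cancel, sym2x_comm 0, sub_eq_add_neg, ← neg_add,
        sym2x_neg_left, hr]
  · rcases P with _ | ⟨x₁, y₁, h₁⟩
    · rw [← zero_def, zero_add, zero_sub, sym2x_neg_right]
      refine ⟨1, ?_⟩
      rcases Q with _ | ⟨x₂, y₂, h₂⟩
      · rw [← zero_def]
        simp [eval_addSubMap]
      · rw [eval_addSubMap]
        ext i
        fin_cases i <;> simp <;> ring
    rcases Q with _ | ⟨x₂, y₂, h₂⟩
    · rw [← zero_def, add_zero, sub_zero]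
      refine ⟨1, ?_⟩
      rw [eval_addSubMap]
      ext i
      fin_cases i <;> simp <;> ring
    · exact addSubMap_sym2x_of_X_ne h₁ h₂ fun hx => h (X_eq_iff.mp hx)

end WeierstrassCurve.Affine.Point

/-! ### The degree of an endomorphism -/

namespace WeierstrassCurve.EndAux

open Filter Polynomial

variable {L : Type*} [Field L] {V : Affine L}

theorem eq_zero_of_eventually_eval [Infinite V.Point] {f : L[X]}
    (hf : ∀ᶠ P : V.Point in cofinite, f.eval (xc P) = 0) : f = 0 := by
  by_contra h
  obtain ⟨P, h1, h2⟩ := (hf.and (finite_of_poly (V := V) f h).compl_mem_cofinite).exists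
  exact h2 h1

theorem eventually_eval_ne_zero {f : L[X]} (hf : f ≠ 0) :
    ∀ᶠ P : V.Point in cofinite, f.eval (xc P) ≠ 0 :=
  (finite_of_poly (V := V) f hf).compl_mem_cofinite

theorem equation_coord {P : V.Point} (hP : P ≠ 0) : V.Equation (xc P) (yc P) := by
  rcases P with _ | ⟨x, y, h⟩
  · exact absurd rfl hP
  · exact h.1

theorem xc_neg (P : V.Point) : xc (-P) = xc P := by
  rcases P with _ | ⟨x, y, h⟩ <;> rfl

theorem yc_neg {P : V.Point} (hP : P ≠ 0) : yc (-P) = V.negY (xc P) (yc P) := by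
  rcases P with _ | ⟨x, y, h⟩
  · exact absurd rfl hP
  · rfl

theorem xRep_of_ne_zero {P : V.Point} (hP : P ≠ 0) : P.xRep = ![xc P, 1] := by
  rcases P with _ | ⟨x, y, h⟩
  · exact absurd rfl hP
  · rfl

/-- On the curve, every polynomial in the coordinates is of the form `p(x) + q(x) y`. -/
theorem exists_linear_in_y (V : Affine L) (a : MvPolynomial (Fin 2) L) :
    ∃ p q : L[X], ∀ x y, V.Equation x y →
      MvPolynomial.aeval ![x, y] a = p.eval x + q.eval x * y := by
  induction a using MvPolynomial.induction_on with
  | C r => exact ⟨C r, 0, fun x y _ => by simp⟩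
  | add a b ha hb =>
    obtain ⟨p, q, h⟩ := ha
    obtain ⟨p', q', h'⟩ := hb
    refine ⟨p + p', q + q', fun x y hxy => ?_⟩
    rw [map_add, h x y hxy, h' x y hxy, eval_add, eval_add]
    ring
  | mul_X a i ha =>
    obtain ⟨p, q, h⟩ := ha
    fin_cases i
    · refine ⟨p * X, q * X, fun x y hxy => ?_⟩
      simp only [map_mul, h x y hxy, MvPolynomial.aeval_X, eval_mul, eval_X]
      simp
      ring
    · refine ⟨q * (X ^ 3 + C V.a₂ * X ^ 2 + C V.a₄ * X + C V.a₆),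
        p - q * (C V.a₁ * X + C V.a₃), fun x y hxy => ?_⟩
      have e := (Affine.equation_iff' _ _).mp hxy
      simp only [map_mul, h x y hxy, MvPolynomial.aeval_X]
      simp
      linear_combination (eval x q) * e

/-- The exceptional affine points are 2-torsion, and their `x` is a root of `4x³ + b₂x² + 2b₄x +
b₆`. If this polynomial were zero then `4 = b₂ = b₆ = 0`, hence `Δ = -8b₄³ = 0`. -/
theorem eventually_Y_ne_negY [V.IsElliptic] :
    ∀ᶠ P : V.Point in cofinite, yc P ≠ V.negY (xc P) (yc P) := by
  have hΔ : V.Δ ≠ 0 := V.isUnit_Δ.ne_zero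
  have hne : C 4 * X ^ 3 + C V.b₂ * X ^ 2 + C (2 * V.b₄) * X + C V.b₆ ≠ (0 : L[X]) := by
    intro h0
    have h3 : (4 : L) = 0 := by simpa using congrArg (coeff · 3) h0
    have h2 : V.b₂ = 0 := by
      simpa [coeff_X, coeff_C] using congrArg (coeff · 2) h0
    have h6 : V.b₆ = 0 := by
      simpa [coeff_X, coeff_C] using congrArg (coeff · 0) h0
    apply hΔ
    rw [WeierstrassCurve.Δ, h2, h6]
    linear_combination (-2 * V.b₄ ^ 3) * h3
  filter_upwards [eventually_eval_ne_zero hne, eventually_ne_zero] with P h1 h2 h3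
  apply h1
  have e := (Affine.equation_iff' _ _).mp (equation_coord h2)
  rw [Affine.negY] at h3
  simp [b₂, b₄, b₆]
  linear_combination (2 * yc P + V.a₁ * xc P + V.a₃) * h3 - 4 * e

theorem eventually_neg {p : V.Point → Prop} [DecidableEq L] (h : ∀ᶠ P in cofinite, p P) :
    ∀ᶠ P in cofinite, p (-P) :=
  neg_injective.tendsto_cofinite.eventually h

/-- An even rational function is a rational function of `x`. -/
theorem Rat.exists_eval_xc [DecidableEq L] [V.IsElliptic] [Infinite V.Point] {u : V.Point → L}
    (hu : Rat L u) (heven : ∀ P, u (-P) = u P) :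
    ∃ A B : L[X], B ≠ 0 ∧ ∀ᶠ P in cofinite, u P * B.eval (xc P) = A.eval (xc P) := by
  obtain ⟨a, c, h⟩ := hu
  obtain ⟨p, q, hpq⟩ := exists_linear_in_y V a
  obtain ⟨r, s, hrs⟩ := exists_linear_in_y V c
  -- With `u = (p + q y) / (r + s y)`, compare `P` and `-P`: subtracting and cancelling the
  -- difference of the two y-coordinates gives `u s = q`, and then `u r = p`.
  have key : ∀ᶠ P in cofinite,
      u P * r.eval (xc P) = p.eval (xc P) ∧ u P * s.eval (xc P) = q.eval (xc P) ∧
      r.eval (xc P) + s.eval (xc P) * yc P ≠ 0 := by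
    filter_upwards [h, eventually_neg h, eventually_ne_zero, eventually_Y_ne_negY]
      with P h1 h2 hP hy
    have hP' : -P ≠ 0 := neg_ne_zero.mpr hP
    rw [hpq _ _ (equation_coord hP), hrs _ _ (equation_coord hP)] at h1
    rw [hpq _ _ (equation_coord hP'), hrs _ _ (equation_coord hP'), heven, xc_neg,
      yc_neg hP] at h2
    have e1 := (eq_div_iff h1.1).mp h1.2
    have e2 := (eq_div_iff h2.1).mp h2.2
    have e3 : u P * s.eval (xc P) = q.eval (xc P) := by
      apply mul_right_cancel₀ (sub_ne_zero.mpr hy)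
      linear_combination e1 - e2
    exact ⟨by linear_combination e1 - yc P * e3, e3, h1.1⟩
  by_cases hs : s = 0
  · refine ⟨p, r, ?_, key.mono fun P h => h.1⟩
    rintro rfl
    obtain ⟨P, hP⟩ := key.exists
    exact hP.2.2 (by simp [hs])
  · exact ⟨q, s, hs, key.mono fun P h => h.2.1⟩

/-! ### Degree as the height of the x-coordinate map -/

variable [DecidableEq L]

/-- The vector `s` of polynomials in `x` describes the `x`-coordinate of `φ` at almost all
points. -/
def Describes (φ : V.Point →+ V.Point) (s : Fin 2 → L[X]) : Prop :=
  ∀ᶠ P in cofinite, ∃ u : L, u ≠ 0 ∧ (fun i => (s i).eval (xc P)) = u • (φ P).xRep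

/-- `φ` has degree `n`. -/
def HasDegree (φ : V.Point →+ V.Point) (n : ℕ) : Prop :=
  ∃ s : Fin 2 → L[X], HasHeight s n ∧ Describes φ s

theorem HasDegree.unique [IsAlgClosed L] [Infinite V.Point] {φ : V.Point →+ V.Point} {m n : ℕ}
    (hm : HasDegree φ m) (hn : HasDegree φ n) : m = n := by
  obtain ⟨s, hs, hs'⟩ := hm
  obtain ⟨t, ht, ht'⟩ := hn
  refine hs.unique ht fun i j => ?_
  rw [← sub_eq_zero]
  refine eq_zero_of_eventually_eval (V := V) ?_
  filter_upwards [hs', ht'] with P h1 h2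
  obtain ⟨u, -, h1⟩ := h1
  obtain ⟨v, -, h2⟩ := h2
  have e1 : ∀ i, (s i).eval (xc P) = u * (φ P).xRep i := congrFun h1
  have e2 : ∀ i, (t i).eval (xc P) = v * (φ P).xRep i := congrFun h2
  simp only [eval_sub, eval_mul, e1, e2]
  ring

theorem hasDegree_zero : HasDegree (0 : V.Point →+ V.Point) 0 := by
  refine ⟨![1, 0], ⟨?_, ?_, ?_⟩, Eventually.of_forall fun P => ⟨1, one_ne_zero, ?_⟩⟩
  · intro i
    fin_cases i <;> simp
  · intro x h
    simpa using congrFun h 0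
  · intro h
    simpa using congrFun h 0
  · ext i
    fin_cases i <;> simp

/-- Each coordinate of `φ P` minus that of `Q` is a rational function, so it vanishes almost
everywhere or almost nowhere. If both vanish almost everywhere, `φ` is almost everywhere constant,
hence zero. -/
theorem eventually_ne [Infinite V.Point] {k : Type*} [Field k] [Algebra k L]
    {φ : V.Point →+ V.Point} (hφ : Good k φ) (h0 : φ ≠ 0) (Q : V.Point) :
    ∀ᶠ P in cofinite, φ P ≠ Q := by
  obtain ⟨g0, gx, gy⟩ := given_iff.mp (hφ.resolve_left h0)
  by_cases hQ : Q = 0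
  · subst hQ; exact g0
  rcases (gx.extend.sub (Rat.const (xc Q))).dich with e1 | e1
  · rcases (gy.extend.sub (Rat.const (yc Q))).dich with e2 | e2
    · refine absurd (hom_const (Q := Q) ?_) h0
      filter_upwards [g0, e1, e2] with P g e1 e2
      exact ext_coord g hQ (by simpa [sub_eq_zero] using e1) (by simpa [sub_eq_zero] using e2)
    · filter_upwards [e2] with P hP hPQ
      exact hP (by simp [hPQ])
  · filter_upwards [e1] with P hP hPQ
    exact hP (by simp [hPQ])

theorem tendsto_cofinite [Infinite V.Point] {k : Type*} [Field k] [Algebra k L]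
    {φ : V.Point →+ V.Point} (hφ : Good k φ) (h0 : φ ≠ 0) : Tendsto φ cofinite cofinite := by
  rw [Filter.Tendsto, Filter.le_cofinite_iff_eventually_ne]
  exact eventually_ne hφ h0

theorem exists_hasDegree [V.IsElliptic] [Infinite V.Point] {k : Type*} [Field k] [Algebra k L]
    {φ : V.Point →+ V.Point} (hφ : Good k φ) : ∃ n, HasDegree φ n := by
  by_cases h0 : φ = 0
  · exact ⟨0, h0 ▸ hasDegree_zero⟩
  obtain ⟨g0, gx, -⟩ := given_iff.mp (hφ.resolve_left h0)
  obtain ⟨A, B, hB, hAB⟩ := gx.extend.exists_eval_xc fun P => by rw [map_neg, xc_neg]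
  obtain ⟨A', B', c, hco, rfl, rfl⟩ :=
    UniqueFactorizationMonoid.exists_reduced_factors' A B hB
  obtain ⟨n, hn⟩ := IsCoprime.hasHeight (s := ![A', B']) hco.isCoprime
  refine ⟨n, _, hn, ?_⟩
  filter_upwards [g0, hAB, eventually_eval_ne_zero hB] with P h1 h2 h3
  rw [eval_mul, mul_ne_zero_iff] at h3
  refine ⟨B'.eval (xc P), h3.2, ?_⟩
  rw [eval_mul, eval_mul] at h2
  have h4 : xc (φ P) * B'.eval (xc P) = A'.eval (xc P) :=
    mul_left_cancel₀ h3.1 (by linear_combination h2)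
  rw [xRep_of_ne_zero h1]
  ext i
  fin_cases i
  · simp [← h4, mul_comm]
  · simp

/-- In height zero the x-coordinate of `φ` is almost everywhere constant, so its values are confined
to one pair `±Q`. This contradicts the finiteness of the fibres. -/
theorem HasDegree.pos [Infinite V.Point] {k : Type*} [Field k] [Algebra k L]
    {φ : V.Point →+ V.Point} (hφ : Good k φ) (h0 : φ ≠ 0) {n : ℕ} (hn : HasDegree φ n) :
    0 < n := by
  obtain ⟨s, hs, hs'⟩ := hn
  rw [Nat.pos_iff_ne_zero]
  rintro rfl
  have hc : ∀ i, s i = C ((s i).coeff 0) := fun i =>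
    eq_C_of_natDegree_le_zero (hs.natDegree_le i)
  obtain ⟨P, ⟨u, hu, hP⟩, hP0⟩ := (hs'.and (eventually_ne hφ h0 0)).exists
  obtain ⟨R, ⟨⟨v, hv, hR⟩, hR0⟩, hR1, hR2⟩ := ((hs'.and (eventually_ne hφ h0 0)).and
    ((eventually_ne hφ h0 (φ P)).and (eventually_ne hφ h0 (-φ P)))).exists
  have hPR : u • (φ P).xRep = v • (φ R).xRep := by
    rw [← hP, ← hR]
    ext i
    rw [hc i, eval_C, eval_C]
  have hx : (φ R).xRep = (φ P).xRep := by
    rw [xRep_of_ne_zero hP0, xRep_of_ne_zero hR0] at hPR ⊢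
    have h1 : u = v := by simpa using congrFun hPR 1
    subst h1
    have h2 : u * xc (φ P) = u * xc (φ R) := by simpa using congrFun hPR 0
    rw [mul_left_cancel₀ hu h2]
  exact (Affine.Point.eq_or_eq_neg_of_xRep_eq_xRep hx).elim hR1 hR2

/-- At almost all points, `sym2 v w` and `addSubMap` applied to `sym2 s t` are proportional, both
representing the symmetric functions of the x-coordinates of `φ + ψ` and `φ - ψ`. Their heights are
`c + d` and `2 * (a + b)`. -/
theorem HasDegree.parallelogram [IsAlgClosed L] [V.IsElliptic] [Infinite V.Point]
    {φ ψ : V.Point →+ V.Point} {a b c d : ℕ} (ha : HasDegree φ a) (hb : HasDegree ψ b)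
    (hc : HasDegree (φ + ψ) c) (hd : HasDegree (φ - ψ) d) : c + d = 2 * (a + b) := by
  obtain ⟨s, hs, hs'⟩ := ha
  obtain ⟨t, ht, ht'⟩ := hb
  obtain ⟨v, hv, hv'⟩ := hc
  obtain ⟨w, hw, hw'⟩ := hd
  refine (hv.sym2 hw).unique ((hs.sym2 ht).aeval (F := addSubMap V)
    (isHomogeneous_addSubMap V) fun _ => addSubMap_ne_zero V) fun i j => ?_
  rw [← sub_eq_zero]
  refine eq_zero_of_eventually_eval (V := V) ?_
  filter_upwards [hs', ht', hv', hw'] with P h1 h2 h3 h4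
  have hsym : ∀ {s t : Fin 2 → L[X]} {Q R : V.Point},
      (∃ u : L, u ≠ 0 ∧ (fun i => (s i).eval (xc P)) = u • Q.xRep) →
      (∃ u : L, u ≠ 0 ∧ (fun i => (t i).eval (xc P)) = u • R.xRep) →
      ∃ u : L, (fun i => (sym2 s t i).eval (xc P)) = u • Q.sym2x R := by
    rintro s t Q R ⟨u, -, hu⟩ ⟨v, -, hv⟩
    have e1 : ∀ i, (s i).eval (xc P) = u * Q.xRep i := congrFun hu
    have e2 : ∀ i, (t i).eval (xc P) = v * R.xRep i := congrFun hv
    refine ⟨u * v, ?_⟩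
    ext i
    fin_cases i <;> simp [sym2, Affine.Point.sym2x, e1, e2] <;> ring
  obtain ⟨e, he⟩ := hsym h1 h2
  obtain ⟨f, hf⟩ := hsym h3 h4
  obtain ⟨r, hr⟩ := Affine.Point.addSubMap_sym2x (φ P) (ψ P)
  have hf' : ∀ i, (sym2 v w i).eval (xc P) = f * (φ P + ψ P).sym2x (φ P - ψ P) i :=
    congrFun hf
  have hr' := congrFun (Affine.Point.eval_smul_addSubMap V e ((φ P).sym2x (ψ P)))
  rw [hr] at hr'
  simp only [Pi.smul_apply, smul_eq_mul] at hr'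
  simp only [eval_sub, eval_mul, eval_mvPolynomial_aeval, he, hf', hr']
  ring

theorem HasDegree.comp [Infinite V.Point] {k : Type*} [Field k] [Algebra k L]
    {φ ψ : V.Point →+ V.Point} {a b : ℕ} (ha : HasDegree φ a) (hb : HasDegree ψ b)
    (hψ : Good k ψ) (h0 : ψ ≠ 0) : HasDegree (φ.comp ψ) (a * b) := by
  obtain ⟨s, hs, hs'⟩ := ha
  obtain ⟨t, ht, ht'⟩ := hb
  refine ⟨_, hs.comp ht, ?_⟩
  filter_upwards [(tendsto_cofinite hψ h0).eventually hs', ht', eventually_ne hψ h0 0]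
    with P h1 h2 h3
  obtain ⟨u, hu, h1⟩ := h1
  obtain ⟨v, hv, h2⟩ := h2
  rw [xRep_of_ne_zero h3] at h2
  -- The homogenization of `s` has degree `a`, so rescaling the representative of `x(ψ P)` by `v`
  -- costs `v ^ a`.
  refine ⟨v ^ a * u, mul_ne_zero (pow_ne_zero _ hv) hu, ?_⟩
  rw [mul_smul, AddMonoidHom.comp_apply, ← h1]
  ext i
  rw [eval_mvPolynomial_aeval, h2, eval_homogenize (hs.natDegree_le i) _ (by simpa using hv)]
  simp [hv, mul_comm]

end WeierstrassCurve.EndAux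

/-! ### Rings with a multiplicative positive definite quadratic form -/

/-- A positive definite multiplicative degree function, subject to the parallelogram law. -/
structure IsDegreeForm {R : Type*} [Ring R] (d : R → ℤ) : Prop where
  parallelogram : ∀ a b, d (a + b) + d (a - b) = 2 * (d a + d b)
  mul : ∀ a b, d (a * b) = d a * d b
  eq_zero : ∀ a, d a = 0 → a = 0

namespace IsDegreeForm

variable {R : Type*} [Ring R] {d : R → ℤ}

theorem map_zero (hd : IsDegreeForm d) : d 0 = 0 := by
  have := hd.parallelogram 0 0
  rw [add_zero, sub_zero] at this
  linarith

theorem map_neg (hd : IsDegreeForm d) (a : R) : d (-a) = d a := by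
  have := hd.parallelogram 0 a
  rw [zero_add, zero_sub, hd.map_zero] at this
  linarith

theorem map_one [Nontrivial R] (hd : IsDegreeForm d) : d 1 = 1 := by
  have h1 := hd.mul 1 1
  rw [mul_one] at h1
  have h2 : d 1 ≠ 0 := fun h => one_ne_zero (hd.eq_zero 1 h)
  exact (mul_eq_left₀ h2).mp h1.symm

/-- The Jordan–von Neumann argument: four instances of the parallelogram law eliminate all terms
with differences. -/
theorem polar_add (hd : IsDegreeForm d) (x y z : R) :
    QuadraticMap.polar d (x + y) z = QuadraticMap.polar d x z + QuadraticMap.polar d y z := by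
  have h1 := hd.parallelogram (x + z) y
  have h2 := hd.parallelogram (y + z) x
  have h3 := hd.parallelogram (x - y) z
  have h4 := hd.parallelogram x y
  have h5 := hd.map_neg (y + z - x)
  rw [show x + z + y = x + y + z by abel] at h1
  rw [show y + z + x = x + y + z by abel] at h2
  rw [show x - y + z = x + z - y by abel, show x - y - z = -(y + z - x) by abel, h5] at h3
  simp only [QuadraticMap.polar]
  linarith

/-- The bilinear form of a degree form, as an additive map in its first argument. -/
def polarHom (hd : IsDegreeForm d) (z : R) : R →+ ℤ :=
  AddMonoidHom.mk' (fun x => QuadraticMap.polar d x z) fun x y => hd.polar_add x y z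

theorem polarHom_apply (hd : IsDegreeForm d) (x z : R) :
    hd.polarHom z x = QuadraticMap.polar d x z := rfl

theorem polarHom_comm (hd : IsDegreeForm d) (x z : R) :
    hd.polarHom z x = hd.polarHom x z :=
  QuadraticMap.polar_comm d x z

theorem polarHom_self (hd : IsDegreeForm d) (x : R) : hd.polarHom x x = 2 * d x := by
  have := hd.parallelogram x x
  rw [sub_self, hd.map_zero] at this
  rw [polarHom_apply, QuadraticMap.polar]
  linarith

theorem polarHom_mul (hd : IsDegreeForm d) (a x y : R) :
    hd.polarHom (a * y) (a * x) = d a * hd.polarHom y x := by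
  simp only [polarHom_apply, QuadraticMap.polar, ← mul_add, hd.mul]
  ring

/-- The cross terms of `polarHom_mul` at `a + 1`. It says that `polarHom 1 a - a` is adjoint to left
multiplication by `a`. -/
theorem polarHom_mul_add (hd : IsDegreeForm d) [Nontrivial R] (a x y : R) :
    hd.polarHom y (a * x) + hd.polarHom (a * y) x = hd.polarHom 1 a * hd.polarHom y x := by
  have h1 := hd.polarHom_mul (a + 1) x y
  rw [add_mul, add_mul, one_mul, one_mul, _root_.map_add, hd.polarHom_comm (a * x),
    hd.polarHom_comm x, _root_.map_add, _root_.map_add, hd.polarHom_comm (a * y) (a * x),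
    hd.polarHom_mul, hd.polarHom_comm y (a * x), hd.polarHom_comm y x] at h1
  have h2 : hd.polarHom 1 a = d (a + 1) - d a - d 1 := rfl
  rw [h2, hd.map_one]
  linarith [hd.polarHom_comm x (a * y)]

/-- Every element is a root of its characteristic polynomial. -/
theorem mul_self_eq [Nontrivial R] (hd : IsDegreeForm d) (a : R) :
    a * a = hd.polarHom 1 a • a - d a • (1 : R) := by
  -- The defect of the quadratic equation is orthogonal to everything, in particular to itself, so
  -- its degree is zero.
  have key : ∀ y, hd.polarHom y (a * a - (hd.polarHom 1 a • a - d a • (1 : R))) = 0 := by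
    intro y
    have h1 := hd.polarHom_mul_add a a y
    have h2 := hd.polarHom_mul a 1 y
    rw [mul_one] at h2
    rw [map_sub, map_sub, map_zsmul, map_zsmul, smul_eq_mul, smul_eq_mul]
    linarith
  have h := key (a * a - (hd.polarHom 1 a • a - d a • (1 : R)))
  rw [hd.polarHom_self] at h
  exact sub_eq_zero.mp (hd.eq_zero _ (by linarith))

theorem map_zsmul_one [Nontrivial R] (hd : IsDegreeForm d) (n : ℤ) : d (n • (1 : R)) = n ^ 2 := by
  have h1 := hd.polarHom_self (n • (1 : R))
  rw [map_zsmul, hd.polarHom_comm, map_zsmul, hd.polarHom_self, hd.map_one] at h1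
  simp only [smul_eq_mul] at h1
  linarith

end IsDegreeForm

/-! ### Quadratic division algebras -/

section QuadraticAlgebra

variable {F D : Type*} [Field F] [Ring D] [Algebra F D]

theorem noZeroDivisors_of_isUnit (hu : ∀ x : D, x ≠ 0 → IsUnit x) : NoZeroDivisors D where
  eq_zero_or_eq_zero_of_mul_eq_zero {a b} h := by
    by_contra! hc
    exact hc.2 ((hu a hc.1).mul_right_eq_zero.mp h)

/-- Completing the square in the equation of `a` gives `i` with scalar square. The commutator `j = i
* b - b * i` then anticommutes with `i`; since `j * j` commutes with `i`, its equation has no linear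
term. -/
theorem exists_anticommuting (h2 : (2 : F) ≠ 0)
    (hq : ∀ x : D, ∃ t n : F, x * x = t • x + n • (1 : D)) (hu : ∀ x : D, x ≠ 0 → IsUnit x)
    {a b : D} (hab : a * b ≠ b * a) :
    ∃ (i j : D) (α β : F), i ≠ 0 ∧ j ≠ 0 ∧ i * i = α • (1 : D) ∧ j * j = β • (1 : D) ∧
      j * i = -(i * j) := by
  have := noZeroDivisors_of_isUnit hu
  obtain ⟨t, n, ht⟩ := hq a
  obtain ⟨i, hi⟩ : ∃ i, i = a - (t / 2) • (1 : D) := ⟨_, rfl⟩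
  have hii : i * i = (n + t ^ 2 / 4) • (1 : D) := by
    rw [hi]
    simp only [mul_sub, sub_mul, ht, smul_mul_assoc, mul_smul_comm, one_mul, mul_one]
    have h4 : (4 : F) ≠ 0 := by
      rw [show (4 : F) = 2 * 2 by norm_num]
      exact mul_ne_zero h2 h2
    match_scalars <;> field_simp <;> ring
  have hib : i * b ≠ b * i := by
    rw [hi, sub_mul, mul_sub, smul_mul_assoc, mul_smul_comm, one_mul, mul_one]
    exact fun h => hab (sub_left_injective h)
  have hi0 : i ≠ 0 := by
    rintro h
    rw [h] at hib
    simp at hib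
  have hj0 : i * b - b * i ≠ 0 := sub_ne_zero.mpr hib
  obtain ⟨j, hj⟩ : ∃ j, j = i * b - b * i := ⟨_, rfl⟩
  rw [← hj] at hj0
  have hji : j * i = -(i * j) := by
    have e : b * (i * i) = i * i * b := by rw [hii]; simp
    rw [hj, sub_mul, mul_sub, mul_assoc b, e]
    simp only [mul_assoc]
    abel
  obtain ⟨s, m, hs⟩ := hq j
  refine ⟨i, j, n + t ^ 2 / 4, m, hi0, hj0, hii, ?_, hji⟩
  have h1 : j * j * i = i * (j * j) := by
    rw [mul_assoc, hji, mul_neg, ← mul_assoc, hji, neg_mul, neg_neg, mul_assoc]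
  rw [hs, add_mul, mul_add, smul_mul_assoc, mul_smul_comm, hji, smul_mul_assoc, mul_smul_comm,
    one_mul, mul_one] at h1
  have h3 : (2 * s) • (i * j) = 0 := by
    have := add_right_cancel h1
    rw [smul_neg] at this
    rw [mul_smul, two_smul]
    nth_rewrite 1 [← this]
    exact neg_add_cancel _
  have hs0 : s = 0 := by
    rcases smul_eq_zero.mp h3 with h | h
    · exact (mul_eq_zero.mp h).resolve_left h2
    · exact absurd h (mul_ne_zero hi0 hj0)
  rw [hs, hs0, zero_smul, zero_add]

theorem not_scalar_of_anticommuting (h2 : (2 : F) ≠ 0) {i j : D} [NoZeroDivisors D]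
    (hi : i ≠ 0) (hj : j ≠ 0) (hji : j * i = -(i * j)) (p : F) : i ≠ p • (1 : D) := by
  intro h
  rw [h, smul_mul_assoc, mul_smul_comm, one_mul, mul_one] at hji
  have h3 : (2 * p) • j = 0 := by
    rw [mul_smul, two_smul]
    nth_rewrite 1 [hji]
    exact neg_add_cancel _
  rcases smul_eq_zero.mp h3 with h4 | h4
  · rw [(mul_eq_zero.mp h4).resolve_left h2, zero_smul] at h
    exact hi h
  · exact hj h4

/-- Expanding the square of `y + i` for commuting `y` and `i` gives `y * (2i - c)` as a combination
of `1` and `i`. Multiplying by the conjugate `2i + c` solves for `y`; the norm `4α - c²` is nonzero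
because `i` is not a scalar. -/
theorem eq_of_commute (h2 : (2 : F) ≠ 0)
    (hq : ∀ x : D, ∃ t n : F, x * x = t • x + n • (1 : D)) [NoZeroDivisors D]
    {i : D} {α : F} (hii : i * i = α • (1 : D)) (hi : ∀ p : F, i ≠ p • (1 : D)) {y : D}
    (hy : y * i = i * y) : ∃ p q : F, y = p • (1 : D) + q • i := by
  obtain ⟨t, n, ht⟩ := hq y
  obtain ⟨s, m, hs⟩ := hq (y + i)
  have h1 : y * ((2 : F) • i - (s - t) • (1 : D)) = s • i + (m - n - α) • (1 : D) := by
    rw [add_mul, mul_add, mul_add, ht, hii, ← hy] at hs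
    rw [mul_sub, mul_smul_comm, mul_smul_comm, mul_one]
    linear_combination (norm := module) hs
  have h3 : ((2 : F) • i - (s - t) • (1 : D)) * ((2 : F) • i + (s - t) • (1 : D)) =
      (4 * α - (s - t) ^ 2) • (1 : D) := by
    simp only [sub_mul, mul_add, smul_mul_assoc, mul_smul_comm, hii, one_mul, mul_one]
    module
  have hne : 4 * α - (s - t) ^ 2 ≠ 0 := by
    intro h
    rw [h, zero_smul] at h3
    rcases mul_eq_zero.mp h3 with h4 | h4
    · apply hi ((s - t) / 2)
      rw [div_eq_inv_mul, mul_smul, ← sub_eq_zero.mp h4, smul_smul, inv_mul_cancel₀ h2, one_smul]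
    · apply hi (-(s - t) / 2)
      rw [div_eq_inv_mul, mul_smul, neg_smul, ← eq_neg_of_add_eq_zero_left h4, smul_smul,
        inv_mul_cancel₀ h2, one_smul]
  have h5 : (4 * α - (s - t) ^ 2) • y =
      (2 * s * α + (m - n - α) * (s - t)) • (1 : D) + (s * (s - t) + 2 * (m - n - α)) • i := by
    have := congrArg (· * ((2 : F) • i + (s - t) • (1 : D))) h1
    simp only [mul_assoc, h3] at this
    rw [mul_smul_comm, mul_one] at this
    rw [this]
    simp only [add_mul, mul_add, smul_mul_assoc, mul_smul_comm, hii, one_mul, mul_one]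
    module
  refine ⟨(4 * α - (s - t) ^ 2)⁻¹ * (2 * s * α + (m - n - α) * (s - t)),
    (4 * α - (s - t) ^ 2)⁻¹ * (s * (s - t) + 2 * (m - n - α)), ?_⟩
  rw [mul_smul, mul_smul, ← smul_add, ← h5, smul_smul, inv_mul_cancel₀ hne, one_smul]

/-- A noncommutative division algebra all of whose elements are quadratic is a quaternion
algebra. -/
theorem isQuaternionAlgebra_of_quadratic (h2 : (2 : F) ≠ 0)
    (hq : ∀ x : D, ∃ t n : F, x * x = t • x + n • (1 : D)) (hu : ∀ x : D, x ≠ 0 → IsUnit x)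
    {a b : D} (hab : a * b ≠ b * a) :
    Algebra.IsCentral F D ∧ IsSimpleRing D ∧ Module.finrank F D = 4 := by
  have := noZeroDivisors_of_isUnit hu
  obtain ⟨i, j, α, β, hi, hj, hii, hjj, hji⟩ := exists_anticommuting h2 hq hu hab
  have hns := not_scalar_of_anticommuting h2 hi hj hji
  have hα : α ≠ 0 := by
    rintro rfl
    rw [zero_smul] at hii
    exact hi (mul_self_eq_zero.mp hii)
  have hβ : β ≠ 0 := by
    rintro rfl
    rw [zero_smul] at hjj
    exact hj (mul_self_eq_zero.mp hjj)
  have hind : ∀ p q : F, p • (1 : D) + q • i = 0 → p = 0 ∧ q = 0 := by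
    intro p q h
    have hq0 : q = 0 := by
      by_contra hq0
      apply hns (-(q⁻¹ * p))
      rw [neg_smul, mul_smul, eq_neg_of_add_eq_zero_left h, smul_neg, smul_smul,
        inv_mul_cancel₀ hq0, one_smul, neg_neg]
    rw [hq0, zero_smul, add_zero] at h
    refine ⟨(smul_eq_zero.mp h).resolve_right ?_, hq0⟩
    rintro h1
    exact hi (by rw [← mul_one i, h1, mul_zero])
  refine ⟨⟨fun x hx => ?_⟩, ?_, ?_⟩
  · rw [Subalgebra.mem_center_iff] at hx
    obtain ⟨p, q, rfl⟩ := eq_of_commute h2 hq hii hns (hx i).symm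
    have h3 : (2 * q) • (i * j) = 0 := by
      have := hx j
      simp only [add_mul, mul_add, smul_mul_assoc, mul_smul_comm, one_mul, mul_one, hji] at this
      have := add_left_cancel this
      rw [smul_neg] at this
      rw [mul_smul, two_smul]
      nth_rewrite 1 [← this]
      exact neg_add_cancel _
    have hq0 : q = 0 := by
      rcases smul_eq_zero.mp h3 with h | h
      · exact (mul_eq_zero.mp h).resolve_left h2
      · exact absurd h (mul_ne_zero hi hj)
    rw [hq0, zero_smul, add_zero, Algebra.mem_bot]
    exact ⟨p, Algebra.algebraMap_eq_smul_one p⟩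
  · have : Nontrivial D := ⟨i, 0, hi⟩
    let := DivisionRing.ofIsUnitOrEqZero fun x : D => or_iff_not_imp_right.mpr (hu x)
    exact (inferInstance : IsSimpleRing D)
  · have hlin : LinearIndependent F ![1, i, j, i * j] := by
      rw [Fintype.linearIndependent_iff]
      intro g hg
      simp only [Fin.sum_univ_four, Matrix.cons_val] at hg
      -- Adding the products of the relation with `i` on both sides cancels the part that
      -- anticommutes with `i`.
      have h1 : (g 0 • (1 : D) + g 1 • i) * i = 0 := by
        have e1 := congrArg (· * i) hg
        have e2 := congrArg (i * ·) hg
        have e3 : i * j * i = -(α • j) := by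
          rw [mul_assoc, hji, mul_neg, ← mul_assoc, hii, smul_mul_assoc, one_mul]
        have e4 : i * (i * j) = α • j := by rw [← mul_assoc, hii, smul_mul_assoc, one_mul]
        simp only [add_mul, mul_add, smul_mul_assoc, mul_smul_comm, one_mul, mul_one, zero_mul,
          mul_zero, e3, e4, hji] at e1 e2 ⊢
        have e5 : (2 : F) • (g 0 • i + g 1 • (i * i)) = 0 := by
          linear_combination (norm := module) e1 + e2
        exact (smul_eq_zero.mp e5).resolve_left h2
      obtain ⟨g0, g1⟩ := hind _ _ ((mul_eq_zero.mp h1).resolve_right hi)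
      have h3 : (g 2 • (1 : D) + g 3 • i) * j = 0 := by
        rw [g0, g1] at hg
        simpa [add_mul] using hg
      obtain ⟨g2, g3⟩ := hind _ _ ((mul_eq_zero.mp h3).resolve_right hj)
      intro l
      fin_cases l
      exacts [g0, g1, g2, g3]
    have hspan : ⊤ ≤ Submodule.span F (Set.range ![1, i, j, i * j]) := by
      intro x _
      -- Conjugation by `i` splits `2α x` into a part commuting with `i` and a part anticommuting
      -- with it. Multiplying the latter by `j` brings it back to the centralizer of `i`, spanned by
      -- `1` and `i`.
      have hc : (α • x + i * x * i) * i = i * (α • x + i * x * i) := by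
        simp only [add_mul, mul_add, mul_assoc, hii, smul_mul_assoc, mul_smul_comm, mul_one]
        simp only [← mul_assoc, hii, smul_mul_assoc, one_mul]
        abel
      have hc' : (α • x - i * x * i) * j * i = i * ((α • x - i * x * i) * j) := by
        rw [mul_assoc, hji]
        simp only [sub_mul, mul_sub, mul_assoc, smul_mul_assoc, mul_smul_comm, mul_neg]
        simp only [← mul_assoc, hii, smul_mul_assoc, one_mul]
        simp only [mul_smul_comm]
        abel
      obtain ⟨p, q, hpq⟩ := eq_of_commute h2 hq hii hns hc
      obtain ⟨r, s, hrs⟩ := eq_of_commute h2 hq hii hns hc'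
      have h3 : β • (α • x - i * x * i) = r • j + s • (i * j) := by
        have := congrArg (· * j) hrs
        simpa only [mul_assoc, hjj, add_mul, smul_mul_assoc, mul_smul_comm, mul_one,
          one_mul] using this
      have h4 : (2 * α * β) • x = (β * p) • (1 : D) + (β * q) • i + r • j + s • (i * j) := by
        linear_combination (norm := module) β • hpq + h3
      have h5 : x = (2 * α * β)⁻¹ •
          ((β * p) • (1 : D) + (β * q) • i + r • j + s • (i * j)) := by
        rw [← h4, smul_smul, inv_mul_cancel₀ (mul_ne_zero (mul_ne_zero h2 hα) hβ), one_smul]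
      have hmem : ∀ l, ![1, i, j, i * j] l ∈ Submodule.span F (Set.range ![1, i, j, i * j]) :=
        fun l => Submodule.subset_span ⟨l, rfl⟩
      rw [h5]
      exact Submodule.smul_mem _ _ (Submodule.add_mem _ (Submodule.add_mem _ (Submodule.add_mem _
        (Submodule.smul_mem _ _ (hmem 0)) (Submodule.smul_mem _ _ (hmem 1)))
        (Submodule.smul_mem _ _ (hmem 2))) (Submodule.smul_mem _ _ (hmem 3)))
    simpa using Module.finrank_eq_card_basis (Module.Basis.mk hlin hspan)

end QuadraticAlgebra

/-! ### The endomorphism algebra -/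

namespace WeierstrassCurve

section Degree

open EndAux Filter

variable {k : Type*} [Field k] (E : WeierstrassCurve k) [E.IsElliptic]

instance isElliptic_baseChange_algebraicClosure :
    (Affine.baseChange E (AlgebraicClosure k)).IsElliptic :=
  inferInstanceAs (WeierstrassCurve.map E (algebraMap k (AlgebraicClosure k))).IsElliptic

variable {E}

theorem exists_hasDegree_endRing (φ : E.EndRing) :
    ∃ n : ℕ, HasDegree (V := Affine.baseChange E (AlgebraicClosure k)) φ.1 n :=
  exists_hasDegree (k := k) φ.2

/-- The degree of an endomorphism. -/
noncomputable def endDegree (φ : E.EndRing) : ℕ :=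
  (exists_hasDegree_endRing φ).choose

theorem hasDegree_endDegree (φ : E.EndRing) :
    HasDegree (V := Affine.baseChange E (AlgebraicClosure k)) φ.1 (endDegree φ) :=
  (exists_hasDegree_endRing φ).choose_spec

instance nontrivial_endRing : Nontrivial E.EndRing := by
  obtain ⟨P, hP⟩ := exists_ne (0 : E.GeomPoint)
  refine ⟨1, 0, fun h => hP ?_⟩
  exact DFunLike.congr_fun (congrArg Subtype.val h) P

theorem endDegree_zero : endDegree (0 : E.EndRing) = 0 :=
  (hasDegree_endDegree 0).unique hasDegree_zero

theorem endDegree_parallelogram (φ ψ : E.EndRing) :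
    endDegree (φ + ψ) + endDegree (φ - ψ) = 2 * (endDegree φ + endDegree ψ) :=
  (hasDegree_endDegree φ).parallelogram (hasDegree_endDegree ψ) (hasDegree_endDegree (φ + ψ))
    (hasDegree_endDegree (φ - ψ))

theorem endDegree_mul (φ ψ : E.EndRing) :
    endDegree (φ * ψ) = endDegree φ * endDegree ψ := by
  by_cases hψ : ψ = 0
  · rw [hψ, mul_zero, endDegree_zero, mul_zero]
  · exact (hasDegree_endDegree (φ * ψ)).unique
      ((hasDegree_endDegree φ).comp (hasDegree_endDegree ψ) (k := k) ψ.2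
        fun h => hψ (Subtype.ext h))

theorem eq_zero_of_endDegree_eq_zero {φ : E.EndRing} (h : endDegree φ = 0) : φ = 0 := by
  by_contra h0
  exact ((hasDegree_endDegree φ).pos (k := k) φ.2 fun h => h0 (Subtype.ext h)).ne' h

theorem isDegreeForm_endDegree : IsDegreeForm fun φ : E.EndRing => (endDegree φ : ℤ) where
  parallelogram φ ψ := by exact_mod_cast endDegree_parallelogram φ ψ
  mul φ ψ := by exact_mod_cast endDegree_mul φ ψ
  eq_zero φ h := eq_zero_of_endDegree_eq_zero (by exact_mod_cast h)

end Degree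

/-! ### Frobenius is central and has degree `q` -/

section Frobenius

open EndAux Filter

variable {k : Type*} [Field k] [Fintype k] (E : WeierstrassCurve k)

/-- The `q`-power Frobenius map on the geometric points. -/
noncomputable def frobeniusHom : E.GeomPoint →+ E.GeomPoint :=
  Affine.Point.map (W' := E) (FiniteField.frobeniusAlgHom k (AlgebraicClosure k))

theorem frobeniusHom_ne_zero {P : E.GeomPoint} (hP : P ≠ 0) : E.frobeniusHom P ≠ 0 := by
  rcases P with _ | ⟨x, y, h⟩
  · exact absurd rfl hP
  · rw [frobeniusHom, Affine.Point.map_some]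
    exact Affine.Point.some_ne_zero _

theorem xc_frobeniusHom (P : E.GeomPoint) :
    xc (E.frobeniusHom P) = FiniteField.frobeniusAlgHom k (AlgebraicClosure k) (xc P) := by
  rcases P with _ | ⟨x, y, h⟩
  · exact (map_zero _).symm
  · rfl

theorem yc_frobeniusHom (P : E.GeomPoint) :
    yc (E.frobeniusHom P) = FiniteField.frobeniusAlgHom k (AlgebraicClosure k) (yc P) := by
  rcases P with _ | ⟨x, y, h⟩
  · exact (map_zero _).symm
  · rfl

theorem hasDegree_frobeniusHom : HasDegree E.frobeniusHom (Fintype.card k) := by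
  refine ⟨![Polynomial.X ^ Fintype.card k, 1], ⟨?_, ?_, ?_⟩, ?_⟩
  · intro i
    fin_cases i <;> simp
  · intro x h
    simpa using congrFun h 1
  · intro h
    simpa using congrFun h 0
  · filter_upwards [eventually_ne_zero] with P hP
    refine ⟨1, one_ne_zero, ?_⟩
    rw [xRep_of_ne_zero (E.frobeniusHom_ne_zero hP), xc_frobeniusHom]
    ext i
    fin_cases i <;> simp

variable [E.IsElliptic]

theorem good_frobeniusHom : Good k E.frobeniusHom :=
  E.frobeniusEnd.2

theorem endDegree_frobeniusEnd : endDegree E.frobeniusEnd = Fintype.card k :=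
  (hasDegree_endDegree _).unique E.hasDegree_frobeniusHom

theorem frobeniusEnd_ne_zero : E.frobeniusEnd ≠ 0 := by
  intro h
  have h1 := E.endDegree_frobeniusEnd
  rw [h, endDegree_zero] at h1
  exact Fintype.card_ne_zero h1.symm

theorem aeval_frobenius (x y : AlgebraicClosure k) (a : MvPolynomial (Fin 2) k) :
    MvPolynomial.aeval ![FiniteField.frobeniusAlgHom k (AlgebraicClosure k) x,
      FiniteField.frobeniusAlgHom k (AlgebraicClosure k) y] a =
      FiniteField.frobeniusAlgHom k (AlgebraicClosure k) (MvPolynomial.aeval ![x, y] a) := by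
  rw [← AlgHom.comp_apply, MvPolynomial.comp_aeval]
  congr 2
  ext i
  fin_cases i <;> rfl

theorem frobeniusHom_comp {φ : E.GeomPoint →+ E.GeomPoint} (hφ : Good k φ) :
    E.frobeniusHom.comp φ = φ.comp E.frobeniusHom := by
  by_cases hφ0 : φ = 0
  · subst hφ0
    ext P
    simp
  have hπ0 : E.frobeniusHom ≠ 0 := fun h => E.frobeniusEnd_ne_zero (Subtype.ext h)
  obtain ⟨g0, ⟨a, c, g1⟩, ⟨b, d, g2⟩⟩ := given_iff.mp (hφ.resolve_left hφ0)
  have ht := tendsto_cofinite E.good_frobeniusHom hπ0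
  rw [← sub_eq_zero]
  -- The q-power map fixes the coefficients in `k` of the rational functions, so both composites
  -- agree at almost all points; a homomorphism vanishing almost everywhere is zero.
  refine hom_const (Q := 0) ?_
  filter_upwards [g0, g1, g2, ht.eventually g0, ht.eventually g1, ht.eventually g2]
    with P h0 h1 h2 h0' h1' h2'
  rw [AddMonoidHom.sub_apply, sub_eq_zero, AddMonoidHom.comp_apply, AddMonoidHom.comp_apply]
  refine ext_coord (E.frobeniusHom_ne_zero h0) h0' ?_ ?_
  · rw [h1'.2, xc_frobeniusHom, xc_frobeniusHom, yc_frobeniusHom, aeval_frobenius,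
      aeval_frobenius, ← map_div₀, h1.2]
  · rw [h2'.2, yc_frobeniusHom, xc_frobeniusHom, yc_frobeniusHom, aeval_frobenius,
      aeval_frobenius, ← map_div₀, h2.2]

/-- The Frobenius endomorphism commutes with all endomorphisms defined over `k`. -/
theorem frobeniusEnd_commute (φ : E.EndRing) : E.frobeniusEnd * φ = φ * E.frobeniusEnd :=
  Subtype.ext (E.frobeniusHom_comp φ.2)

end Frobenius

end WeierstrassCurve

/-! ### Extension of scalars from `ℤ` to `ℚ` -/

section RationalAlgebra

variable {R : Type*} [Ring R]

theorem exists_eq_smul_one_tmul (x : ℚ ⊗[ℤ] R) :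
    ∃ (c : ℚ) (a : R), x = c • ((1 : ℚ) ⊗ₜ[ℤ] a) := by
  have h : ∃ (m : ℤ) (a : R), m ≠ 0 ∧ (m : ℚ) • x = (1 : ℚ) ⊗ₜ[ℤ] a := by
    induction x with
    | zero => exact ⟨1, 0, one_ne_zero, by simp⟩
    | tmul r a =>
      refine ⟨r.den, r.num • a, by exact_mod_cast r.den_ne_zero, ?_⟩
      rw [← TensorProduct.smul_tmul, TensorProduct.smul_tmul']
      congr 1
      simp [Rat.den_mul_eq_num]
    | add x y hx hy =>
      obtain ⟨m, a, hm, hx⟩ := hx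
      obtain ⟨n, b, hn, hy⟩ := hy
      refine ⟨m * n, n • a + m • b, mul_ne_zero hm hn, ?_⟩
      rw [TensorProduct.tmul_add, TensorProduct.tmul_smul, TensorProduct.tmul_smul, ← hx, ← hy]
      simp only [← Int.cast_smul_eq_zsmul ℚ, Int.cast_mul]
      module
  obtain ⟨m, a, hm, h⟩ := h
  refine ⟨(m : ℚ)⁻¹, a, ?_⟩
  rw [← h, smul_smul, inv_mul_cancel₀ (by exact_mod_cast hm), one_smul]

theorem one_tmul_zsmul (n : ℤ) (a : R) :
    (1 : ℚ) ⊗ₜ[ℤ] (n • a) = (n : ℚ) • ((1 : ℚ) ⊗ₜ[ℤ] a) := by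
  rw [TensorProduct.tmul_smul, Int.cast_smul_eq_zsmul]

namespace IsDegreeForm

variable {d : R → ℤ} [Nontrivial R]

theorem one_tmul_mul_self (hd : IsDegreeForm d) (a : R) :
    (1 : ℚ) ⊗ₜ[ℤ] a * (1 : ℚ) ⊗ₜ[ℤ] a =
      (hd.polarHom 1 a : ℚ) • ((1 : ℚ) ⊗ₜ[ℤ] a) - (d a : ℚ) • (1 : ℚ ⊗[ℤ] R) := by
  rw [Algebra.TensorProduct.tmul_mul_tmul, one_mul, hd.mul_self_eq, TensorProduct.tmul_sub,
    one_tmul_zsmul, one_tmul_zsmul]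
  rfl

theorem exists_mul_self_eq (hd : IsDegreeForm d) (x : ℚ ⊗[ℤ] R) :
    ∃ t n : ℚ, x * x = t • x + n • (1 : ℚ ⊗[ℤ] R) := by
  obtain ⟨c, a, rfl⟩ := exists_eq_smul_one_tmul x
  refine ⟨c * hd.polarHom 1 a, -(c ^ 2 * d a), ?_⟩
  rw [smul_mul_smul_comm, hd.one_tmul_mul_self]
  module

/-- The quadratic equation exhibits `(tr(a) - a) / d(a)` as the inverse. -/
theorem isUnit_one_tmul (hd : IsDegreeForm d) {a : R} (ha : a ≠ 0) :
    IsUnit ((1 : ℚ) ⊗ₜ[ℤ] a) := by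
  have hda : (d a : ℚ) ≠ 0 := by exact_mod_cast fun h => ha (hd.eq_zero a h)
  have h := hd.one_tmul_mul_self a
  refine isUnit_iff_exists.mpr
    ⟨(d a : ℚ)⁻¹ • ((hd.polarHom 1 a : ℚ) • (1 : ℚ ⊗[ℤ] R) - (1 : ℚ) ⊗ₜ[ℤ] a), ?_, ?_⟩
  · rw [mul_smul_comm, mul_sub, mul_smul_comm, mul_one, h, sub_sub_cancel, smul_smul,
      inv_mul_cancel₀ hda, one_smul]
  · rw [smul_mul_assoc, sub_mul, smul_mul_assoc, one_mul, h, sub_sub_cancel, smul_smul,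
      inv_mul_cancel₀ hda, one_smul]

theorem isUnit_of_ne_zero (hd : IsDegreeForm d) {x : ℚ ⊗[ℤ] R} (hx : x ≠ 0) : IsUnit x := by
  obtain ⟨c, a, rfl⟩ := exists_eq_smul_one_tmul x
  have hc : c ≠ 0 := by
    rintro rfl
    simp at hx
  have ha : a ≠ 0 := by
    rintro rfl
    simp at hx
  exact (hd.isUnit_one_tmul ha).smul (Units.mk0 c hc)

theorem eq_zero_of_one_tmul_eq_zero (hd : IsDegreeForm d) [Nontrivial (ℚ ⊗[ℤ] R)] {a : R}
    (h : (1 : ℚ) ⊗ₜ[ℤ] a = 0) : a = 0 := by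
  by_contra ha
  exact not_isUnit_zero (h ▸ hd.isUnit_one_tmul ha)

/-- An integral element that becomes a rational scalar `r` has degree `r ^ 2`. -/
theorem sq_eq_of_one_tmul_eq (hd : IsDegreeForm d) [Nontrivial (ℚ ⊗[ℤ] R)] {a : R} {r : ℚ}
    (h : (1 : ℚ) ⊗ₜ[ℤ] a = r • (1 : ℚ ⊗[ℤ] R)) : r ^ 2 = d a := by
  -- With denominators cleared, the identity already holds in `R`, where degrees can be compared.
  have h1 : (r.den : ℤ) • a - r.num • (1 : R) = 0 := by
    apply hd.eq_zero_of_one_tmul_eq_zero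
    rw [TensorProduct.tmul_sub, one_tmul_zsmul, one_tmul_zsmul, h, smul_smul]
    have : ((r.den : ℤ) : ℚ) * r = r.num := by
      rw [Int.cast_natCast, Rat.den_mul_eq_num]
    rw [this]
    exact sub_self _
  have h2 : (r.den : ℤ) ^ 2 * d a = r.num ^ 2 := by
    rw [← hd.map_zsmul_one, ← hd.map_zsmul_one, ← hd.mul, ← sub_eq_zero.mp h1,
      smul_mul_assoc, one_mul]
  have h3 : ((r.den : ℚ)) ^ 2 * d a = r.num ^ 2 := by exact_mod_cast h2
  have h4 : (r.den : ℚ) ≠ 0 := by exact_mod_cast r.den_ne_zero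
  have h5 : r ^ 2 = (r.num : ℚ) ^ 2 / (r.den : ℚ) ^ 2 := by
    rw [← div_pow, Rat.num_div_den]
  rw [h5, ← h3, mul_div_cancel_left₀ _ (pow_ne_zero 2 h4)]

end IsDegreeForm

end RationalAlgebra

/-! ### Reduced norms of scalars and the Weil group -/

/-- In dimension 4 every splitting space is a plane, on which a scalar has determinant its square.
-/
theorem IsReducedNorm.smul_one {F : Type*} [Field F] {A : Type*} [Ring A] [Algebra F A]
    (hA : Module.finrank F A = 4) (r : F) : IsReducedNorm F (r • (1 : A)) (r ^ 2) := by
  intro K V _ _ _ _ _ e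
  have h1 : Module.finrank K V * Module.finrank K V = 2 * 2 := by
    rw [← Module.finrank_linearMap, ← e.toLinearEquiv.finrank_eq, Module.finrank_baseChange, hA]
  have h2 : Module.finrank K V = 2 := Nat.mul_self_inj.mp h1
  have h3 : e (1 ⊗ₜ[F] (r • (1 : A))) = algebraMap F K r • (1 : Module.End K V) := by
    rw [TensorProduct.tmul_smul, ← algebraMap_smul K r, map_smul, ← Algebra.TensorProduct.one_def,
      map_one]
  rw [h3, LinearMap.det_smul, h2, map_one, mul_one, map_pow]

section WeilGroup

variable (k : Type*) [Field k] [Fintype k]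

/-- If the `n`-th power were trivial, `X ^ (q ^ n) - X` would vanish on the whole infinite field. -/
theorem orderOf_geomFrobenius : orderOf (geomFrobenius k) = 0 := by
  refine (orderOf_inv (G := AlgebraicClosure k ≃ₐ[k] AlgebraicClosure k) _).trans ?_
  rw [orderOf_eq_zero_iff']
  intro n hn h
  have hq : 1 < Fintype.card k ^ n := Nat.one_lt_pow hn.ne' Fintype.one_lt_card
  have hx : ∀ x : AlgebraicClosure k, x ^ (Fintype.card k ^ n) = x := by
    intro x
    have := DFunLike.congr_fun h x
    rwa [AlgEquiv.coe_pow, FiniteField.coe_frobeniusAlgEquivOfAlgebraic_iterate] at this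
  have h0 : (Polynomial.X ^ (Fintype.card k ^ n) - Polynomial.X :
      Polynomial (AlgebraicClosure k)) = 0 := by
    apply Polynomial.funext
    intro x
    simp [hx]
  exact FiniteField.X_pow_card_sub_X_ne_zero _ hq h0

theorem mem_zpowers_weilGeomFrobenius (g : weilGroup k) :
    g ∈ Subgroup.zpowers (weilGeomFrobenius k) := by
  obtain ⟨g, n, rfl⟩ := g
  exact ⟨n, rfl⟩

theorem existsUnique_weilGroup_hom {G : Type*} [Group G] (t : G) :
    ∃! ρ : weilGroup k →* G, ρ (weilGeomFrobenius k) = t := by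
  have h0 : orderOf (weilGeomFrobenius k) = 0 := by
    rw [← orderOf_geomFrobenius k]
    exact Subgroup.orderOf_mk _ _
  have hdvd : orderOf t ∣ orderOf (weilGeomFrobenius k) := h0 ▸ dvd_zero _
  refine ⟨monoidHomOfForallMemZpowers (mem_zpowers_weilGeomFrobenius k) hdvd,
    monoidHomOfForallMemZpowers_apply_gen _ hdvd, fun ρ hρ => ?_⟩
  rw [MonoidHom.eq_iff_eq_on_generator (mem_zpowers_weilGeomFrobenius k), hρ]
  exact (monoidHomOfForallMemZpowers_apply_gen _ hdvd).symm

end WeilGroup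

/-! ### The main theorem -/

theorem mainTheorem7 {k : Type*} [Field k] [Fintype k] (E : WeierstrassCurve k) [E.IsElliptic]
    (σ : E.EndAlgebra → E.EndAlgebra) (hσ : E.IsSpinStructure σ) :
    (Algebra.IsCentral ℚ E.EndAlgebra ∧ IsSimpleRing E.EndAlgebra ∧
      Module.finrank ℚ E.EndAlgebra = 4) ∧
    ∃ τ : E.EndAlgebraˣ,
      (τ : E.EndAlgebra) = E.frobenius ∧
      σ τ * τ = algebraMap ℚ E.EndAlgebra (Fintype.card k) ∧
      IsReducedNorm ℚ (τ : E.EndAlgebra) (Fintype.card k : ℚ) ∧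
      τ ∈ GO ℚ hσ.firstKind ∧
      ∃ hτ : τ ∈ GOPlus ℚ hσ.firstKind,
        ∃! ρ : weilGroup k →* GOPlus ℚ hσ.firstKind, ρ (weilGeomFrobenius k) = ⟨τ, hτ⟩ := by
  have hd := WeierstrassCurve.isDegreeForm_endDegree (E := E)
  -- In a commutative algebra everything is central, so the only involution of the first kind is the
  -- identity.
  obtain ⟨a, b, hab⟩ : ∃ a b : E.EndAlgebra, a * b ≠ b * a := by
    by_contra! hc
    obtain ⟨s, hs, hne⟩ := hσ.spinorial
    exact hne (funext fun x => hs.map_center x (Subring.mem_center_iff.mpr fun y => hc y x))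
  have hB := isQuaternionAlgebra_of_quadratic (two_ne_zero (α := ℚ)) hd.exists_mul_self_eq
    (fun x hx => hd.isUnit_of_ne_zero hx) hab
  have hnt : Nontrivial E.EndAlgebra := ⟨_, _, hab⟩
  refine ⟨hB, ?_⟩
  have hcen : E.frobenius ∈ Subalgebra.center ℚ E.EndAlgebra := by
    rw [Subalgebra.mem_center_iff]
    intro x
    obtain ⟨c, φ, rfl⟩ := exists_eq_smul_one_tmul x
    rw [WeierstrassCurve.frobenius, smul_mul_assoc, mul_smul_comm,
      Algebra.TensorProduct.tmul_mul_tmul, Algebra.TensorProduct.tmul_mul_tmul,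
      E.frobeniusEnd_commute]
  obtain ⟨r, hr⟩ := Algebra.mem_bot.mp (hB.1.out hcen)
  have hr' : E.frobenius = r • (1 : E.EndAlgebra) := by
    rw [← hr, Algebra.algebraMap_eq_smul_one]
  have hrq : r ^ 2 = (Fintype.card k : ℚ) := by
    rw [hd.sq_eq_of_one_tmul_eq hr', E.endDegree_frobeniusEnd, Int.cast_natCast]
  have hq0 : (Fintype.card k : ℚ) ≠ 0 := by exact_mod_cast Fintype.card_ne_zero
  obtain ⟨τ, hτ⟩ := hd.isUnit_one_tmul E.frobeniusEnd_ne_zero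
  have hτ' : (τ : E.EndAlgebra) = r • (1 : E.EndAlgebra) := hτ.trans hr'
  have hmul : σ τ * τ = algebraMap ℚ E.EndAlgebra (Fintype.card k) := by
    have hσc : σ τ = τ := hσ.firstKind.map_center _ (Subring.mem_center_iff.mpr fun x => by
      rw [hτ', mul_smul_comm, smul_mul_assoc, one_mul, mul_one])
    rw [hσc, hτ', smul_mul_smul_comm, one_mul, ← hrq, Algebra.algebraMap_eq_smul_one, sq]
  have hnrd : IsReducedNorm ℚ (τ : E.EndAlgebra) (Fintype.card k : ℚ) := by
    rw [hτ', ← hrq]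
    exact IsReducedNorm.smul_one hB.2.2 r
  -- The degree is 2, so properness compares the reduced norm with the first power of the
  -- multiplier.
  have hdeg : csaDegree ℚ E.EndAlgebra / 2 = 1 := by
    rw [csaDegree, hB.2.2, show (4 : ℕ) = 2 * 2 by rfl, Nat.sqrt_eq]
  refine ⟨τ, hτ, hmul, hnrd, ⟨Units.mk0 _ hq0, hmul⟩, ⟨Units.mk0 _ hq0, hmul, ?_⟩,
    existsUnique_weilGroup_hom k _⟩
  rw [hdeg, pow_one]
  exact hnrd
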